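/- **Setting.** There are $N\ge 1$ arms. The rewards $X_n(1),X_n(2),\dots$ of arm $n$ are i.i.d. with finite mean $\theta_n$. Let $\sigma$ be a permutation with $\theta_{\sigma(1)}\ge\dots\ge\theta_{\sigma(N)}$ and put $\Delta_j=\theta_{\sigma(1)}-\theta_{\sigma(j)}$. Fix a target rank $m\in\{1,\dots,N\}$ and costs $C_m=0$ and $C_j>0$ ($j\ne m$), where $C_j$ is incurred each time the $j$-th best arm $\sigma(j)$ is played; let $C_{\max}=\max_j C_j$. For a policy $\pi$ the regret $R_T^{\pi}(\mathcal F,m)$ is the expected total cost up to time $T$. Let $g_m=\min\{\Delta_m-\Delta_{m-1},\ \Delta_{m+1}-\Delta_m\}$, where a neighbouring rank outside $\{1,\dots,N\}$ is left out of the minimum. **Policy.** An exploration sequence with threshold $h$ is a set $\mathcal A$ of positive integers such that each $t>1$ belongs to $\mathcal A$ if and only if $|\mathcal A(t-1)|<h(t)$, where $\mathcal A(t)=\mathcal A\cap\{1,\dots,t\}$ (whether $1\in\mathcal A$ is arbitrary). The DSEE policy plays the arm $((|\mathcal A(t)|-1)\bmod N)+1$ at a time $t\in\mathcal A$. At a time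 $t\notin\mathcal A$ it plays the arm with the $m$-th largest sample mean in (1)–(3), and the arm with the $m$-th largest truncated sample mean in (4), computed from the $\tau_n(t)$ observations of each arm $n$ at the times in $\mathcal A(t-1)$. Ties are broken arbitrarily, and the choice is arbitrary while some arm has no observation. The truncated sample mean is $$\frac1{\tau_n(t)}\sum_{k=1}^{\tau_n(t)}X_{n,k}\,\mathbf 1\Big\{|X_{n,k}|\le\Big(\frac{uk}{\log(\epsilon_n(t)^{-1})}\Big)^{1/p}\Big\},$$ where $X_{n,k}$ is the $k$-th observation of arm $n$ in $\mathcal A$. **Theorem.** 1. Let $a,\zeta,u_0>0$ be such that either (i) for every arm, $M_n(x)=\mathbb E\,e^{x(X_n(1)-\theta_n)}$ is finite for $|x|\le u_0$, $\zeta\ge\sup_{|x|<u_0}M_n''(x)$ and $a\le\frac1{2\zeta}$; or, more generally, (ii) for all $n$, all $s\ge1$ and all $\eta\in[0,\zeta u_0]$, $\Pr\big(|\frac1s\sum_{t=1}^sX_n(t)-\theta_n|\ge\eta\big)\le2e^{-a\eta^2s}$. Let $0<c<g_m$, $\delta=\min\{c/2,\zeta u_0\}$ and $w>\frac1{a\delta^2}$.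 With threshold $h(t)=N\lceil w\log t\rceil$, the policy satisfies, for all $T$, $$R_T^{\pi}(\mathcal F,m)\le\sum_{j\ne m}\lceil w\log T\rceil C_j+2NC_{\max}\Big(1+\frac1{a\delta^2w-1}\Big).$$ 2. Suppose that all reward distributions are light-tailed (their moment-generating functions are finite in a neighbourhood of $0$) and $g_m>0$. Let $f$ be a positive increasing sequence with $f(t)\to\infty$. With threshold $h(t)=N\lceil f(t)\log t\rceil$, $R_T^{\pi}(\mathcal F,m)=O(f(T)\log T)$. 3. Suppose that all reward distributions have a finite $p$-th absolute moment, $p>1$, and $g_m>0$. Let $v>0$. With threshold $h(t)=vt^{1/p}$ if $p\le2$ and $h(t)=vt^{1/(1+p/2)}$ if $p>2$, $R_T^{\pi}(\mathcal F,m)=O(T^{1/p})$ if $p\le2$ and $R_T^{\pi}(\mathcal F,m)=O(T^{1/(1+p/2)})$ if $p>2$. 4. Suppose that $\mathbb E|X_n(1)|^p\le u$ for all $n$, where $u>0$ and $p\in(1,2]$. Let $a=4^{\frac p{1-p}}u^{\frac1{1-p}}$, $0<\delta<\frac12g_m$ and $w>\frac1{a\delta^{p/(p-1)}}$. With threshold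 $h(t)=N\lceil w\log t\rceil$ and the truncated sample mean with $\epsilon_n(t)=\exp(-a\delta^{p/(p-1)}\tau_n(t))$, for all $T$, $$R_T^{\pi}(\mathcal F,m)\le\sum_{j\ne m}\lceil w\log T\rceil C_j+2NC_{\max}\Big(1+\frac1{a\delta^{p/(p-1)}w-1}\Big).$$ -/

import Mathlib

open MeasureTheory ProbabilityTheory Filter Asymptotics

noncomputable section

namespace DSEE

/-! Arms are the elements of `Fin N`, ranks are also elements of `Fin N` (the rank `j : Fin N`
stands for the `(j+1)`-st best arm), and time runs over the positive integers `t = 1, 2, …`. -/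

/-- The reward processes: `X n t` is the reward of arm `n` at time `t ≥ 1`. For every arm the
rewards are i.i.d. over time and have a finite mean. (Nothing is required of the joint law of
different arms, and nothing at the unused time `0`.) -/
structure IIDRewards {Ω : Type*} [MeasurableSpace Ω] {N : ℕ} (μ : Measure Ω)
    (X : Fin N → ℕ → Ω → ℝ) : Prop where
  measurable : ∀ n t, 1 ≤ t → Measurable (X n t)
  indep : ∀ n, iIndepFun (fun t : ℕ => X n (t + 1)) μ
  identDistrib : ∀ n t, 1 ≤ t → IdentDistrib (X n t) (X n 1) μ μ
  integrable : ∀ n, Integrable (X n 1) μ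

/-- The mean reward of arm `n`. -/
def mean {Ω : Type*} [MeasurableSpace Ω] {N : ℕ} (μ : Measure Ω)
    (X : Fin N → ℕ → Ω → ℝ) (n : Fin N) : ℝ :=
  ∫ ω, X n 1 ω ∂μ

/-- `σ` lists the arms in order of decreasing mean: `σ j` is the `(j+1)`-st best arm. -/
def IsRanking {N : ℕ} (θ : Fin N → ℝ) (σ : Equiv.Perm (Fin N)) : Prop :=
  Antitone fun j => θ (σ j)

/-- `Δ j`: the difference between the largest mean and the mean of the arm of rank `j`. -/
def gap {N : ℕ} [NeZero N] (θ : Fin N → ℝ) (σ : Equiv.Perm (Fin N)) (j : Fin N) : ℝ :=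
  θ (σ 0) - θ (σ j)

/-- `x < min {Δ_m - Δ_{m-1}, Δ_{m+1} - Δ_m}`, where a neighbouring rank that does not exist
(below the first or beyond the last) is left out of the minimum. -/
def BelowNeighbourGaps {N : ℕ} (Δ : Fin N → ℝ) (m : Fin N) (x : ℝ) : Prop :=
  (∀ j : Fin N, (j : ℕ) + 1 = m → x < Δ m - Δ j) ∧
  (∀ j : Fin N, (m : ℕ) + 1 = j → x < Δ j - Δ m)

/-- `𝒜(t)`: the exploration times in `{1, …, t}`. -/
def explUpTo (A : Set ℕ) (t : ℕ) : Finset ℕ :=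
  open Classical in (Finset.Icc 1 t).filter (· ∈ A)

/-- `A` is the exploration sequence with threshold `thr`: a time `t > 1` is included exactly when
`|𝒜(t-1)| < thr t`. Whether `t = 1` is included is left open. -/
def IsExploration (A : Set ℕ) (thr : ℕ → ℝ) : Prop :=
  ∀ t, 1 < t → (t ∈ A ↔ ((explUpTo A (t - 1)).card : ℝ) < thr t)

/-- The (zero-based) label of the arm played at the exploration time `t` in the round-robin order:
`(|𝒜(t)| - 1) mod N`. -/
def roundRobin (N : ℕ) (A : Set ℕ) (t : ℕ) : ℕ :=
  ((explUpTo A t).card - 1) % N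

/-- The exploration times in `{1, …, t}` at which arm `n` is played. -/
def armTimes {N : ℕ} (A : Set ℕ) (n : Fin N) (t : ℕ) : Finset ℕ :=
  (explUpTo A t).filter fun s => roundRobin N A s = n

/-- `τ_n(t)`: the number of observations of arm `n` from exploration that are available at
time `t`, i.e. made at times in `𝒜(t-1)`. -/
def numObs {N : ℕ} (A : Set ℕ) (n : Fin N) (t : ℕ) : ℕ :=
  (armTimes A n (t - 1)).card

/-- The sample mean of arm `n` at time `t`, from the exploration times in `𝒜(t-1)`. -/
def sampleMean {Ω : Type*} {N : ℕ} (X : Fin N → ℕ → Ω → ℝ) (A : Set ℕ)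
    (n : Fin N) (t : ℕ) (ω : Ω) : ℝ :=
  (∑ s ∈ armTimes A n (t - 1), X n s ω) / numObs A n t

/-- The truncated sample mean of arm `n` at time `t`, with `ε_n(t) = exp (-κ τ_n(t))`. The
observation made at time `s ∈ armTimes A n (t-1)` is the `k`-th one of arm `n`, where
`k = |armTimes A n s|`; it is kept if its modulus is at most `(u k / log (1/ε_n(t)))^{1/p}`. -/
def truncMean {Ω : Type*} {N : ℕ} (X : Fin N → ℕ → Ω → ℝ) (A : Set ℕ) (p u κ : ℝ)
    (n : Fin N) (t : ℕ) (ω : Ω) : ℝ :=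
  (∑ s ∈ armTimes A n (t - 1),
    if |X n s ω| ≤ (u * (armTimes A n s).card /
        Real.log (Real.exp (-κ * numObs A n t))⁻¹) ^ (1 / p)
    then X n s ω else 0) / numObs A n t

/-- `S n` is the `(m+1)`-st largest of the numbers `S k` (counted with multiplicity). -/
def IsRankInSample {N : ℕ} (S : Fin N → ℝ) (m n : Fin N) : Prop :=
  (Finset.univ.filter fun k => S n < S k).card ≤ m ∧
  (m : ℕ) < (Finset.univ.filter fun k => S n ≤ S k).card

/-- `π t` (the arm played at time `t`) follows a DSEE policy with exploration sequence `A`, arm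
estimates `est` and target rank `m`: round robin at exploration times and, at exploitation times,
the arm whose estimate has rank `m`. Ties are broken in any measurable way, and the choice at an
exploitation time at which some arm has not yet been observed is unrestricted. -/
structure IsDSEEPolicy {Ω : Type*} [MeasurableSpace Ω] {N : ℕ} (A : Set ℕ)
    (est : Fin N → ℕ → Ω → ℝ) (m : Fin N) (π : ℕ → Ω → Fin N) : Prop where
  measurable : ∀ t, 1 ≤ t → Measurable (π t)
  explore : ∀ t, 1 ≤ t → t ∈ A → ∀ ω, (π t ω : ℕ) = roundRobin N A t
  exploit : ∀ t, 1 ≤ t → t ∉ A → (∀ n : Fin N, 0 < numObs A n t) →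
    ∀ ω, IsRankInSample (fun n => est n t ω) m (π t ω)

/-- The expected total cost up to time `T`, where `C j` is the cost of playing the arm of
rank `j`. -/
def costRegret {Ω : Type*} [MeasurableSpace Ω] {N : ℕ} (μ : Measure Ω)
    (σ : Equiv.Perm (Fin N)) (C : Fin N → ℝ) (π : ℕ → Ω → Fin N) (T : ℕ) : ℝ :=
  ∫ ω, ∑ t ∈ Finset.Icc 1 T, C (σ.symm (π t ω)) ∂μ

/-- `Y` is light-tailed: its moment-generating function is finite around `0`. -/
def LightTailed {Ω : Type*} [MeasurableSpace Ω] (μ : Measure Ω) (Y : Ω → ℝ) : Prop :=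
  ∃ u₀ : ℝ, 0 < u₀ ∧ ∀ u : ℝ, |u| ≤ u₀ → Integrable (fun ω => Real.exp (u * Y ω)) μ

/-- The moment-generating function of every centred reward is finite on `[-u₀, u₀]`, and `ζ` is an
upper bound of its second derivative there. (The bound is asked for inside the interval, where the
function is smooth; by monotone convergence this gives the same supremum.) -/
def LightTailConstants {Ω : Type*} [MeasurableSpace Ω] {N : ℕ} (μ : Measure Ω)
    (X : Fin N → ℕ → Ω → ℝ) (ζ u₀ : ℝ) : Prop :=
  ∀ n,
    (∀ u : ℝ, |u| ≤ u₀ → Integrable (fun ω => Real.exp (u * (X n 1 ω - mean μ X n))) μ) ∧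
    (∀ u : ℝ, |u| < u₀ → iteratedDeriv 2 (mgf (fun ω => X n 1 ω - mean μ X n) μ) u ≤ ζ)

/-- The Chernoff–Hoeffding inequality with constants `a, ζ, u₀` for the average of the first `s`
rewards of every arm. -/
def ChernoffHoeffding {Ω : Type*} [MeasurableSpace Ω] {N : ℕ} (μ : Measure Ω)
    (X : Fin N → ℕ → Ω → ℝ) (a ζ u₀ : ℝ) : Prop :=
  ∀ (n : Fin N) (s : ℕ) (η : ℝ), 1 ≤ s → 0 ≤ η → η ≤ ζ * u₀ →
    μ.real {ω | η ≤ |(∑ t ∈ Finset.Icc 1 s, X n t ω) / s - mean μ X n|}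
      ≤ 2 * Real.exp (-a * η ^ 2 * s)

/-- The exponent `1/p` for `p ≤ 2` and `1/(1+p/2)` for `p > 2`. -/
def heavyExponent (p : ℝ) : ℝ :=
  if p ≤ 2 then 1 / p else 1 / (1 + p / 2)

end DSEE

end

/-!
The regret splits into the cost of exploration, which is deterministic, and the expected cost of
wrong exploitations.

*Exploration.* The round-robin order makes the number of observations of an arm a function of
`|𝒜(t)|` alone (`card_armTimes_eq_count`), and the threshold controls `|𝒜(t)|` from both sides: from
above at all times (`card_explUpTo_lt`), and from below at every exploitation time, because such a
time has been refused by the exploration sequence (`le_numObs`).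

*Exploitation.* If all estimates are within half of the smallest neighbouring gap of the means, the
arm whose estimate has rank `m` is the target arm (`eq_of_isRankInSample`). By a union bound the
regret is therefore governed by the probability that an estimate from `k` observations is off by a
fixed `δ`. Since the exploration times are not random, these observations are `k` i.i.d. rewards.

* For light tails and small `δ` this probability is at most `2 exp (-a δ² k)`: a bound on the
  second derivative of the moment-generating function makes the rewards subgaussian near zero, and
  Chernoff's bound applies (`chernoffHoeffding_of_lightTailConstants`).
* For a finite `p`-th moment it is `O(k ^ (max 1 (p/2) - p))`, by Markov's inequality and a bound on
  the `p`-th moment of a sum of centred i.i.d. variables (`exists_integral_abs_sum_rpow_le`). The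
  latter follows by adding one variable at a time, from the pointwise bound `abs_add_rpow_le`, whose
  linear term has mean zero.
* For the truncated mean with `κ = a δ ^ (p/(p-1))` it is at most `2 exp (-κ k)`: the truncation level
  is at most `b = (u/κ) ^ (1/p)`, which satisfies `b κ = δ/4` by the choice of `a`. The biases of the
  truncated variables average to at most `p δ/4 ≤ δ/2`, and Chernoff's bound with the parameter `1/b`
  and `exp z ≤ 1 + z + z²` for `|z| ≤ 1` handles the remaining `δ/2`
  (`IIDRewards.measureReal_truncMean_le`).

With `k ≥ w log t` the exponential bounds become `2 t ^ (-q)` with `q > 1`, whose sum over `t ≥ 2` is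
at most `2/(q - 1)`; the summand `1` of the stated constant pays for time `1`. If only
`k ≥ f t * log t` with `f → ∞` is known, the exponent is eventually at least `2`, whatever the
constants are, and the errors are still summable. In the heavy-tailed case without
truncation the probability of an error at time `t` is `O(t ^ (e - 1))` with `e = heavyExponent p`, the
exponent that balances exploration against exploitation.
-/

noncomputable section

namespace DSEE

/-! ### The exploration sequence -/

lemma mem_explUpTo {A : Set ℕ} {t s : ℕ} : s ∈ explUpTo A t ↔ (1 ≤ s ∧ s ≤ t) ∧ s ∈ A := by
  simp [explUpTo]

lemma explUpTo_zero (A : Set ℕ) : explUpTo A 0 = ∅ := by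
  simp [explUpTo]

lemma explUpTo_succ_of_mem {A : Set ℕ} {t : ℕ} (h : t + 1 ∈ A) :
    explUpTo A (t + 1) = insert (t + 1) (explUpTo A t) := by
  ext s
  simp only [Finset.mem_insert, mem_explUpTo]
  grind

lemma explUpTo_succ_of_notMem {A : Set ℕ} {t : ℕ} (h : t + 1 ∉ A) :
    explUpTo A (t + 1) = explUpTo A t := by
  ext s
  simp only [mem_explUpTo]
  grind

lemma card_explUpTo_succ_of_mem {A : Set ℕ} {t : ℕ} (h : t + 1 ∈ A) :
    (explUpTo A (t + 1)).card = (explUpTo A t).card + 1 := by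
  rw [explUpTo_succ_of_mem h, Finset.card_insert_of_notMem]
  simp [mem_explUpTo]

lemma card_explUpTo_le (A : Set ℕ) (t : ℕ) : (explUpTo A t).card ≤ t := by
  classical
  calc (explUpTo A t).card ≤ (Finset.Icc 1 t).card := Finset.card_filter_le _ _
    _ = t := by simp

lemma roundRobin_succ {N : ℕ} {A : Set ℕ} {t : ℕ} (h : t + 1 ∈ A) :
    roundRobin N A (t + 1) = (explUpTo A t).card % N := by
  simp [roundRobin, card_explUpTo_succ_of_mem h]

lemma one_le_of_mem_armTimes {N : ℕ} {A : Set ℕ} {n : Fin N} {t s : ℕ}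
    (h : s ∈ armTimes A n t) : 1 ≤ s :=
  (mem_explUpTo.1 (Finset.mem_filter.1 h).1).1.1

lemma armTimes_succ_of_mem {N : ℕ} {A : Set ℕ} {n : Fin N} {t : ℕ} (h : t + 1 ∈ A)
    (hn : (explUpTo A t).card % N = n) :
    armTimes A n (t + 1) = insert (t + 1) (armTimes A n t) := by
  rw [armTimes, explUpTo_succ_of_mem h, Finset.filter_insert, if_pos (by rwa [roundRobin_succ h]),
    armTimes]

lemma armTimes_succ_of_ne {N : ℕ} {A : Set ℕ} {n : Fin N} {t : ℕ}
    (hn : (explUpTo A t).card % N ≠ n) : armTimes A n (t + 1) = armTimes A n t := by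
  by_cases h : t + 1 ∈ A
  · rw [armTimes, explUpTo_succ_of_mem h, Finset.filter_insert,
      if_neg (by rwa [roundRobin_succ h]), armTimes]
  · rw [armTimes, explUpTo_succ_of_notMem h, armTimes]

lemma armTimes_succ_of_notMem {N : ℕ} {A : Set ℕ} {n : Fin N} {t : ℕ} (h : t + 1 ∉ A) :
    armTimes A n (t + 1) = armTimes A n t := by
  rw [armTimes, explUpTo_succ_of_notMem h, armTimes]

lemma succ_notMem_armTimes {N : ℕ} {A : Set ℕ} {n : Fin N} {t : ℕ} :
    t + 1 ∉ armTimes A n t := by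
  simp [armTimes, mem_explUpTo]

/-- The arms are explored in turn, so the number of observations of an arm is determined by the
number of exploration times. -/
lemma card_armTimes_eq_count {N : ℕ} (A : Set ℕ) (n : Fin N) (t : ℕ) :
    (armTimes A n t).card = Nat.count (· ≡ n [MOD N]) (explUpTo A t).card := by
  induction t with
  | zero => simp [armTimes, explUpTo_zero]
  | succ t ih =>
    by_cases h : t + 1 ∈ A
    · rw [card_explUpTo_succ_of_mem h, Nat.count_succ, ← ih]
      have key : ((explUpTo A t).card ≡ n [MOD N]) ↔ (explUpTo A t).card % N = n := by
        rw [Nat.ModEq, Nat.mod_eq_of_lt n.2]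
      by_cases hn : (explUpTo A t).card % N = n
      · rw [armTimes_succ_of_mem h hn, Finset.card_insert_of_notMem succ_notMem_armTimes,
          if_pos (key.2 hn)]
      · rw [armTimes_succ_of_ne hn, if_neg (mt key.1 hn), add_zero]
    · rw [armTimes_succ_of_notMem h, explUpTo_succ_of_notMem h, ih]

lemma card_armTimes_ge_div {N : ℕ} (A : Set ℕ) (n : Fin N) (t : ℕ) :
    (explUpTo A t).card / N ≤ (armTimes A n t).card := by
  rw [card_armTimes_eq_count, Nat.count_modEq_card _ (Fin.pos n)]
  exact Nat.le_add_right _ _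

lemma card_armTimes_le_of_card_le {N : ℕ} {A : Set ℕ} (n : Fin N) {t K : ℕ}
    (h : (explUpTo A t).card ≤ N * K) : (armTimes A n t).card ≤ K := by
  have hN := Fin.pos n
  rw [card_armTimes_eq_count]
  calc Nat.count (· ≡ n [MOD N]) (explUpTo A t).card
      ≤ Nat.count (· ≡ n [MOD N]) (N * K) := Nat.count_monotone _ h
    _ = K := by
      rw [Nat.count_modEq_card _ hN]
      simp [hN]

/-- The observations of an arm are numbered consecutively, starting from one. -/
lemma sum_armTimes_card {N : ℕ} (A : Set ℕ) (n : Fin N) (t : ℕ) (f : ℕ → ℝ) :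
    ∑ s ∈ armTimes A n t, f (armTimes A n s).card
      = ∑ k ∈ Finset.Icc 1 (armTimes A n t).card, f k := by
  induction t with
  | zero => simp [armTimes, explUpTo_zero]
  | succ t ih =>
    by_cases h : t + 1 ∈ A
    · by_cases hn : (explUpTo A t).card % N = n
      · have hc : (armTimes A n (t + 1)).card = (armTimes A n t).card + 1 := by
          rw [armTimes_succ_of_mem h hn, Finset.card_insert_of_notMem succ_notMem_armTimes]
        rw [hc, Finset.sum_Icc_succ_top (by omega), armTimes_succ_of_mem h hn,
          Finset.sum_insert succ_notMem_armTimes, ih, hc, add_comm]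
      · rw [armTimes_succ_of_ne hn, ih]
    · rw [armTimes_succ_of_notMem h, ih]

lemma card_armTimes_mono {N : ℕ} (A : Set ℕ) (n : Fin N) :
    Monotone fun t => (armTimes A n t).card := by
  refine monotone_nat_of_le_succ fun t => ?_
  refine Finset.card_le_card fun s hs => ?_
  simp only [armTimes, Finset.mem_filter, mem_explUpTo] at hs ⊢
  grind

lemma card_armTimes_pos_of_mem {N : ℕ} {A : Set ℕ} {n : Fin N} {t s : ℕ}
    (h : s ∈ armTimes A n t) : 0 < (armTimes A n s).card := by
  refine Finset.card_pos.2 ⟨s, ?_⟩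
  simp only [armTimes, Finset.mem_filter, mem_explUpTo] at h ⊢
  grind

/-- Every time after the first one enters the exploration sequence below a threshold that is at most
`thr T`; only time `1` can enter above it. -/
lemma card_explUpTo_lt {A : Set ℕ} {thr : ℕ → ℝ} (hA : IsExploration A thr)
    (hthr : MonotoneOn thr (Set.Ici 1)) {T : ℕ} (hT : 1 ≤ T) :
    ((explUpTo A T).card : ℝ) < thr T + 1 ∨ (explUpTo A T).card ≤ 1 := by
  suffices H : ∀ t, t ≤ T → ((explUpTo A t).card : ℝ) < thr T + 1 ∨ (explUpTo A t).card ≤ 1 from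
    H T le_rfl
  intro t
  induction t with
  | zero => simp [explUpTo_zero]
  | succ t ih =>
    intro ht
    by_cases h : t + 1 ∈ A
    · rcases Nat.eq_zero_or_pos t with rfl | hpos
      · exact Or.inr (card_explUpTo_le A 1)
      · left
        have h1 := (hA (t + 1) (by omega)).1 h
        rw [Nat.add_sub_cancel] at h1
        have h2 : thr (t + 1) ≤ thr T := hthr (Set.mem_Ici.2 (by omega)) (Set.mem_Ici.2 hT) ht
        rw [card_explUpTo_succ_of_mem h]
        push_cast
        linarith
    · rw [explUpTo_succ_of_notMem h]
      exact ih (by omega)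

lemma card_explUpTo_le_add_one {A : Set ℕ} {thr : ℕ → ℝ} (hA : IsExploration A thr)
    (hthr : MonotoneOn thr (Set.Ici 1)) {T : ℕ} (hT : 1 ≤ T) (h0 : 0 ≤ thr T) :
    ((explUpTo A T).card : ℝ) ≤ thr T + 1 := by
  rcases card_explUpTo_lt hA hthr hT with h | h
  · exact h.le
  · have : ((explUpTo A T).card : ℝ) ≤ 1 := by exact_mod_cast h
    linarith

/-- With a threshold `N * K t`, no arm is explored more than `K T` times up to time `T`. -/
lemma card_armTimes_le {N : ℕ} {A : Set ℕ} {K : ℕ → ℕ}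
    (hA : IsExploration A fun t => (N : ℝ) * K t) (hK : MonotoneOn K (Set.Ici 1)) {T : ℕ}
    (hT : 1 ≤ T) (hKT : 1 ≤ K T) (n : Fin N) : (armTimes A n T).card ≤ K T := by
  have hN := Fin.pos n
  apply card_armTimes_le_of_card_le
  have hmono : MonotoneOn (fun t => (N : ℝ) * K t) (Set.Ici 1) := fun a ha b hb hab =>
    mul_le_mul_of_nonneg_left (by exact_mod_cast hK ha hb hab) (Nat.cast_nonneg _)
  rcases card_explUpTo_lt hA hmono hT with h | h
  · have : (explUpTo A T).card < N * K T + 1 := by exact_mod_cast h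
    omega
  · have := Nat.mul_le_mul hN hKT
    omega

/-- With a threshold `N * K t`, every arm has been observed at least `K t` times when a time `t > 1`
is used for exploitation. -/
lemma le_numObs {N : ℕ} {A : Set ℕ} {K : ℕ → ℕ} (hA : IsExploration A fun t => (N : ℝ) * K t)
    {t : ℕ} (ht : 1 < t) (htA : t ∉ A) (n : Fin N) : K t ≤ numObs A n t := by
  have h : ¬ (((explUpTo A (t - 1)).card : ℝ) < N * K t) := fun h => htA ((hA t ht).2 h)
  have h' : N * K t ≤ (explUpTo A (t - 1)).card := by
    exact_mod_cast not_lt.1 h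
  refine le_trans ?_ (card_armTimes_ge_div A n (t - 1))
  rw [Nat.le_div_iff_mul_le (Fin.pos n), mul_comm]
  exact h'

/-! ### Regret and the exploitation error -/

/-- If every estimate is within `δ` of the mean and the target mean is separated by more than `2 * δ`
from its neighbours, the arm whose estimate has the target rank is the target arm. -/
lemma eq_of_isRankInSample {N : ℕ} [NeZero N] {θ : Fin N → ℝ} {σ : Equiv.Perm (Fin N)}
    (hσ : IsRanking θ σ) {m : Fin N} {δ : ℝ} (hg : BelowNeighbourGaps (gap θ σ) m (2 * δ))
    {S : Fin N → ℝ} (hS : ∀ n, |S n - θ n| < δ) {n : Fin N} (hn : IsRankInSample S m n) :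
    n = σ m := by
  obtain ⟨j, rfl⟩ := σ.surjective n
  congr 1
  -- the estimates separate the ranks above `m`, the rank `m` and the ranks below `m`
  have habove : ∀ i k : Fin N, i < m → m ≤ k → S (σ k) < S (σ i) := by
    intro i k hi hk
    have hm1 : (m : ℕ) - 1 < N := by omega
    have h1 := hg.1 ⟨m - 1, hm1⟩ (by simp; omega)
    have h2 : θ (σ ⟨m - 1, hm1⟩) ≤ θ (σ i) := hσ (by rw [Fin.le_def]; simp; omega)
    have h3 : θ (σ k) ≤ θ (σ m) := hσ hk
    simp only [gap] at h1
    have h4 := abs_lt.1 (hS (σ k))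
    have h5 := abs_lt.1 (hS (σ i))
    linarith
  have hbelow : ∀ i k : Fin N, i ≤ m → m < k → S (σ k) < S (σ i) := by
    intro i k hi hk
    have hm1 : (m : ℕ) + 1 < N := by omega
    have h1 := hg.2 ⟨m + 1, hm1⟩ (by simp)
    have h2 : θ (σ k) ≤ θ (σ ⟨m + 1, hm1⟩) := hσ (by rw [Fin.le_def]; simp; omega)
    have h3 : θ (σ m) ≤ θ (σ i) := hσ hi
    simp only [gap] at h1
    have h4 := abs_lt.1 (hS (σ k))
    have h5 := abs_lt.1 (hS (σ i))
    linarith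
  rcases lt_trichotomy j m with hj | hj | hj
  · exfalso
    refine absurd hn.2 (not_lt.2 ?_)
    calc (Finset.univ.filter fun k => S (σ j) ≤ S k).card
        ≤ ((Finset.Iio m).map σ.toEmbedding).card := by
          refine Finset.card_le_card fun k hk => ?_
          obtain ⟨k, rfl⟩ := σ.surjective k
          simp only [Finset.mem_filter, Finset.mem_univ, true_and] at hk
          simp only [Finset.mem_map_equiv, Equiv.symm_apply_apply, Finset.mem_Iio]
          by_contra hkm
          exact absurd hk (not_le.2 (habove j k hj (not_lt.1 hkm)))
      _ = m := by simp
  · exact hj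
  · exfalso
    refine absurd hn.1 (not_le.2 ?_)
    calc (m : ℕ) < ((Finset.Iic m).map σ.toEmbedding).card := by simp
      _ ≤ _ := by
          refine Finset.card_le_card fun k hk => ?_
          obtain ⟨k, rfl⟩ := σ.surjective k
          simp only [Finset.mem_map_equiv, Equiv.symm_apply_apply, Finset.mem_Iic] at hk
          simp only [Finset.mem_filter, Finset.mem_univ, true_and]
          exact hbelow k j hk hj

lemma exists_belowNeighbourGaps {N : ℕ} {Δ : Fin N → ℝ} {m : Fin N}
    (h : BelowNeighbourGaps Δ m 0) : ∃ δ, 0 < δ ∧ BelowNeighbourGaps Δ m (2 * δ) := by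
  have key : ∀ᶠ δ in nhdsWithin (0 : ℝ) (Set.Ioi 0), BelowNeighbourGaps Δ m (2 * δ) := by
    have lim : Tendsto (fun δ : ℝ => 2 * δ) (nhdsWithin 0 (Set.Ioi 0)) (nhds 0) := by
      have : Tendsto (fun δ : ℝ => 2 * δ) (nhds 0) (nhds (2 * 0)) := tendsto_id.const_mul 2
      rw [mul_zero] at this
      exact this.mono_left nhdsWithin_le_nhds
    refine Filter.Eventually.and ?_ ?_
    · refine Filter.eventually_all.2 fun j => ?_
      by_cases hj : (j : ℕ) + 1 = m
      · filter_upwards [lim.eventually_lt_const (h.1 j hj)] with δ hδ _ using hδ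
      · simp [hj]
    · refine Filter.eventually_all.2 fun j => ?_
      by_cases hj : (m : ℕ) + 1 = j
      · filter_upwards [lim.eventually_lt_const (h.2 j hj)] with δ hδ _ using hδ
      · simp [hj]
  obtain ⟨δ, hδ, hpos⟩ := (key.and self_mem_nhdsWithin).exists
  exact ⟨δ, hpos, hδ⟩

lemma costRegret_nonneg {Ω : Type*} [MeasurableSpace Ω] {μ : Measure Ω} {N : ℕ}
    {σ : Equiv.Perm (Fin N)} {m : Fin N} {C : Fin N → ℝ} {π : ℕ → Ω → Fin N} (hCm : C m = 0)
    (hC : ∀ j, j ≠ m → 0 < C j) (T : ℕ) :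
    0 ≤ costRegret μ σ C π T := by
  refine integral_nonneg fun ω => Finset.sum_nonneg fun t _ => ?_
  rcases eq_or_ne (σ.symm (π t ω)) m with h | h
  · simp [h, hCm]
  · exact (hC _ h).le

section Regret

variable {Ω : Type*} [MeasurableSpace Ω] {μ : Measure Ω} [IsProbabilityMeasure μ] {N : ℕ}
  {σ : Equiv.Perm (Fin N)} {m : Fin N} {C : Fin N → ℝ} {A : Set ℕ} {est : Fin N → ℕ → Ω → ℝ}
  {π : ℕ → Ω → Fin N}

lemma le_ciSup_cost (C : Fin N → ℝ) (j : Fin N) : C j ≤ ⨆ j, C j :=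
  le_ciSup (Set.finite_range C).bddAbove j

lemma ciSup_cost_nonneg (hCm : C m = 0) : 0 ≤ ⨆ j, C j :=
  hCm ▸ le_ciSup_cost C m

lemma integrable_cost (hπ : IsDSEEPolicy A est m π) {t : ℕ} (ht : 1 ≤ t) :
    Integrable (fun ω => C (σ.symm (π t ω))) μ := by
  have hmeas : Measurable fun ω => C (σ.symm (π t ω)) :=
    (measurable_of_finite fun n => C (σ.symm n)).comp (hπ.measurable t ht)
  refine Integrable.of_bound hmeas.aestronglyMeasurable (∑ j, |C j|) (Eventually.of_forall ?_)
  intro ω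
  exact Finset.single_le_sum (f := fun j => |C j|) (fun j _ => abs_nonneg _) (Finset.mem_univ _)

lemma costRegret_eq_sum (hπ : IsDSEEPolicy A est m π) (T : ℕ) :
    costRegret μ σ C π T = ∑ t ∈ Finset.Icc 1 T, ∫ ω, C (σ.symm (π t ω)) ∂μ :=
  integral_finsetSum _ fun _ ht => integrable_cost hπ (Finset.mem_Icc.1 ht).1

lemma integral_cost_le (hπ : IsDSEEPolicy A est m π) (hCm : C m = 0) {t : ℕ} (ht : 1 ≤ t) :
    ∫ ω, C (σ.symm (π t ω)) ∂μ ≤ (⨆ j, C j) * μ.real {ω | π t ω ≠ σ m} := by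
  have hmeas : MeasurableSet {ω | π t ω ≠ σ m} :=
    (hπ.measurable t ht) (MeasurableSet.of_discrete (s := {σ m}ᶜ))
  calc ∫ ω, C (σ.symm (π t ω)) ∂μ
      ≤ ∫ ω, Set.indicator {ω | π t ω ≠ σ m} (fun _ => ⨆ j, C j) ω ∂μ := by
        refine integral_mono (integrable_cost hπ ht)
          ((integrable_const _).indicator hmeas) fun ω => ?_
        by_cases h : π t ω = σ m
        · simp [h, hCm]
        · simp only [Set.indicator, Set.mem_ofPred_eq, ne_eq, h, not_false_eq_true, if_true]
          exact le_ciSup_cost C _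
    _ = _ := by
        rw [integral_indicator_const _ hmeas, smul_eq_mul, mul_comm]

lemma integral_cost_le_ciSup (hπ : IsDSEEPolicy A est m π) (hCm : C m = 0) {t : ℕ}
    (ht : 1 ≤ t) : ∫ ω, C (σ.symm (π t ω)) ∂μ ≤ ⨆ j, C j :=
  (integral_cost_le hπ hCm ht).trans
    (mul_le_of_le_one_right (ciSup_cost_nonneg hCm) measureReal_le_one)

/-- At an exploitation time the wrong arm is played only if some estimate is off by `δ`. -/
lemma measureReal_wrong_le [NeZero N] {θ : Fin N → ℝ} (hσ : IsRanking θ σ) {δ : ℝ}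
    (hg : BelowNeighbourGaps (gap θ σ) m (2 * δ)) (hπ : IsDSEEPolicy A est m π) {t : ℕ}
    (ht : 1 ≤ t) (htA : t ∉ A) (hobs : ∀ n : Fin N, 0 < numObs A n t) :
    μ.real {ω | π t ω ≠ σ m} ≤ ∑ n, μ.real {ω | δ ≤ |est n t ω - θ n|} := by
  refine le_trans (measureReal_mono ?_ (measure_ne_top _ _))
    (measureReal_biUnion_finset_le Finset.univ _)
  intro ω hω
  simp only [Finset.mem_univ, Set.iUnion_true, Set.mem_iUnion, Set.mem_ofPred_eq]
  by_contra! h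
  exact hω (eq_of_isRankInSample hσ hg h (hπ.exploit t ht htA hobs ω))

open Classical in
/-- The cost of exploration is determined by the number of times each arm is explored. -/
lemma costRegret_eq_explore_add_exploit (hπ : IsDSEEPolicy A est m π) (T : ℕ) :
    costRegret μ σ C π T = ∑ j, ((armTimes A (σ j) T).card : ℝ) * C j
      + ∑ t ∈ (Finset.Icc 1 T).filter (· ∉ A), ∫ ω, C (σ.symm (π t ω)) ∂μ := by
  rw [costRegret_eq_sum hπ, ← Finset.sum_filter_add_sum_filter_not _ (· ∈ A)]
  congr 1
  have hexp : (Finset.Icc 1 T).filter (· ∈ A) = explUpTo A T := by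
    ext s
    simp [mem_explUpTo]
  have hval : ∀ t ∈ explUpTo A T, ∫ ω, C (σ.symm (π t ω)) ∂μ
      = ∑ j, if roundRobin N A t = σ j then C j else 0 := by
    intro t ht
    obtain ⟨⟨h1, -⟩, htA⟩ := mem_explUpTo.1 ht
    have hp : ∀ ω, (π t ω : ℕ) = roundRobin N A t := hπ.explore t h1 htA
    have : ∀ ω, C (σ.symm (π t ω)) = ∑ j, if roundRobin N A t = σ j then C j else 0 := by
      intro ω
      rw [Finset.sum_eq_single (σ.symm (π t ω))]
      · simp [hp ω]
      · intro j _ hj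
        rw [if_neg]
        intro h
        apply hj
        rw [Equiv.eq_symm_apply]
        exact Fin.ext (by rw [hp ω, h])
      · simp
    simp_rw [this]
    simp
  rw [hexp, Finset.sum_congr rfl hval, Finset.sum_comm]
  refine Finset.sum_congr rfl fun j _ => ?_
  rw [← Finset.sum_filter, Finset.sum_const, nsmul_eq_mul]
  rfl

lemma sum_card_armTimes_mul_le [NeZero N] (T : ℕ) :
    ∑ j, ((armTimes A (σ j) T).card : ℝ) * C j ≤ (⨆ j, C j) * (explUpTo A T).card := by
  have hcard : ∑ n : Fin N, (armTimes A n T).card = (explUpTo A T).card := by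
    rw [Finset.card_eq_sum_card_fiberwise (t := Finset.univ)
      (f := fun s => (⟨roundRobin N A s, Nat.mod_lt _ (NeZero.pos N)⟩ : Fin N)) (by simp)]
    refine Finset.sum_congr rfl fun n _ => ?_
    simp only [armTimes, Fin.ext_iff]
  calc ∑ j, ((armTimes A (σ j) T).card : ℝ) * C j
      ≤ ∑ j, ((armTimes A (σ j) T).card : ℝ) * ⨆ j, C j :=
        Finset.sum_le_sum fun j _ =>
          mul_le_mul_of_nonneg_left (le_ciSup_cost C j) (Nat.cast_nonneg _)
    _ = (⨆ j, C j) * (explUpTo A T).card := by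
        rw [← Finset.sum_mul, mul_comm, ← hcard,
          Equiv.sum_comp σ fun n => ((armTimes A n T).card : ℝ)]
        push_cast
        rfl

end Regret

/-! ### Sums of powers -/

lemma sum_rpow_sub_one_le {e : ℝ} (he : 0 < e) (he1 : e ≤ 1) (T : ℕ) :
    ∑ t ∈ Finset.Icc 1 T, (t : ℝ) ^ (e - 1) ≤ (T : ℝ) ^ e / e := by
  induction T with
  | zero => simp [Real.zero_rpow he.ne']
  | succ T ih =>
    rw [Finset.sum_Icc_succ_top (by omega)]
    have hT : (0 : ℝ) < ((T + 1 : ℕ) : ℝ) := by positivity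
    -- Bernoulli's inequality for the exponent `e ≤ 1` makes the sum telescope
    have hB := rpow_one_add_le_one_add_mul_self (s := -1 / ((T + 1 : ℕ) : ℝ)) (by
      rw [le_div_iff₀ hT]; push_cast; linarith [(Nat.cast_nonneg T : (0 : ℝ) ≤ T)]) he.le he1
    have h1 : (T : ℝ) ^ e
        = ((T + 1 : ℕ) : ℝ) ^ e * (1 + -1 / ((T + 1 : ℕ) : ℝ)) ^ e := by
      have h2 : (1 + -1 / ((T + 1 : ℕ) : ℝ)) = T / ((T + 1 : ℕ) : ℝ) := by
        field_simp; push_cast; ring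
      rw [h2, Real.div_rpow (Nat.cast_nonneg _) hT.le]
      field_simp
    have h3 : (T : ℝ) ^ e ≤ ((T + 1 : ℕ) : ℝ) ^ e - e * ((T + 1 : ℕ) : ℝ) ^ (e - 1) := by
      rw [h1, Real.rpow_sub_one hT.ne']
      calc _ ≤ ((T + 1 : ℕ) : ℝ) ^ e * (1 + e * (-1 / ((T + 1 : ℕ) : ℝ))) :=
            mul_le_mul_of_nonneg_left hB (by positivity)
        _ = _ := by ring
    rw [le_div_iff₀ he] at ih ⊢
    linarith

lemma sum_rpow_neg_le {q : ℝ} (hq : 1 < q) (T : ℕ) :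
    ∑ t ∈ Finset.Icc 2 T, (t : ℝ) ^ (-q) ≤ 1 / (q - 1) := by
  have hq' : 0 < q - 1 := by linarith
  rcases Nat.lt_or_ge T 1 with h | h
  · rw [Finset.Icc_eq_empty (by omega), Finset.sum_empty]
    positivity
  suffices H : ∑ t ∈ Finset.Icc 2 T, (t : ℝ) ^ (-q) ≤ (1 - (T : ℝ) ^ (1 - q)) / (q - 1) by
    refine H.trans (div_le_div_of_nonneg_right ?_ hq'.le)
    have : 0 ≤ (T : ℝ) ^ (1 - q) := by positivity
    linarith
  induction T, h using Nat.le_induction with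
  | base => simp
  | succ T hT ih =>
    rw [Finset.sum_Icc_succ_top (by omega)]
    have hT0 : (0 : ℝ) < T := by exact_mod_cast hT
    have hT1 : (0 : ℝ) < ((T + 1 : ℕ) : ℝ) := by positivity
    -- Bernoulli's inequality for the negative exponent `1 - q`, through the exponential function
    have h1 : 1 + (q - 1) / ((T + 1 : ℕ) : ℝ) ≤ (T / ((T + 1 : ℕ) : ℝ)) ^ (1 - q) := by
      rw [Real.rpow_def_of_pos (by positivity)]
      have hl := Real.log_le_sub_one_of_pos (x := T / ((T + 1 : ℕ) : ℝ)) (by positivity)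
      have h2 : (T : ℝ) / ((T + 1 : ℕ) : ℝ) - 1 = - (1 / ((T + 1 : ℕ) : ℝ)) := by
        field_simp; push_cast; ring
      rw [h2] at hl
      have h3 := Real.add_one_le_exp (Real.log (T / ((T + 1 : ℕ) : ℝ)) * (1 - q))
      have h4 : (q - 1) / ((T + 1 : ℕ) : ℝ) ≤ Real.log (T / ((T + 1 : ℕ) : ℝ)) * (1 - q) := by
        have := mul_le_mul_of_nonneg_left hl hq'.le
        rw [div_eq_mul_one_div]
        linarith
      linarith
    have h5 : ((T + 1 : ℕ) : ℝ) ^ (1 - q) + (q - 1) * ((T + 1 : ℕ) : ℝ) ^ (-q)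
        ≤ (T : ℝ) ^ (1 - q) := by
      rw [Real.div_rpow hT0.le hT1.le, le_div_iff₀ (by positivity)] at h1
      have h6 : ((T + 1 : ℕ) : ℝ) ^ (-q)
          = ((T + 1 : ℕ) : ℝ) ^ (1 - q) / ((T + 1 : ℕ) : ℝ) := by
        rw [← Real.rpow_sub_one hT1.ne']
        congr 1
        ring
      rw [h6]
      calc _ = (1 + (q - 1) / ((T + 1 : ℕ) : ℝ)) * ((T + 1 : ℕ) : ℝ) ^ (1 - q) := by ring
        _ ≤ _ := h1
    rw [le_div_iff₀ hq'] at ih ⊢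
    linarith

/-! ### Regret bounds from concentration of the estimates -/

section RegretBounds

variable {Ω : Type*} [MeasurableSpace Ω] {μ : Measure Ω} [IsProbabilityMeasure μ] {N : ℕ}
  [NeZero N] {θ : Fin N → ℝ} {σ : Equiv.Perm (Fin N)} {m : Fin N} {C : Fin N → ℝ} {A : Set ℕ}
  {est : Fin N → ℕ → Ω → ℝ} {π : ℕ → Ω → Fin N}

/-- Logarithmic regret of logarithmic exploration, when the probability that an estimate is off by
`δ` decays exponentially in the number of observations. -/
theorem costRegret_le_of_exponential_concentration (hσ : IsRanking θ σ) {δ : ℝ}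
    (hg : BelowNeighbourGaps (gap θ σ) m (2 * δ)) (hCm : C m = 0) (hC : ∀ j, j ≠ m → 0 < C j)
    {κ w : ℝ} (hκ : 0 < κ) (hw : 1 / κ < w)
    (hA : IsExploration A fun t => (N : ℝ) * ⌈w * Real.log t⌉₊) (hπ : IsDSEEPolicy A est m π)
    (hconc : ∀ n t, 0 < numObs A n t →
      μ.real {ω | δ ≤ |est n t ω - θ n|} ≤ 2 * Real.exp (-κ * numObs A n t)) (T : ℕ) :
    costRegret μ σ C π T ≤ (∑ j ∈ Finset.univ.erase m, (⌈w * Real.log T⌉₊ : ℝ) * C j)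
      + 2 * N * (⨆ j, C j) * (1 + 1 / (κ * w - 1)) := by
  classical
  have hw0 : 0 < w := lt_trans (by positivity) hw
  have hq : 1 < κ * w := by rwa [div_lt_iff₀' hκ] at hw
  have hM := ciSup_cost_nonneg hCm
  have hN : (1 : ℝ) ≤ N := by exact_mod_cast NeZero.pos N
  have hq' : 0 < 1 / (κ * w - 1) := by
    have : 0 < κ * w - 1 := by linarith
    positivity
  have hCnn : ∀ j, 0 ≤ C j := fun j => by
    rcases eq_or_ne j m with rfl | h
    · exact hCm.ge
    · exact (hC j h).le
  have hexplnn : 0 ≤ ∑ j ∈ Finset.univ.erase m, (⌈w * Real.log T⌉₊ : ℝ) * C j :=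
    Finset.sum_nonneg fun j _ => mul_nonneg (Nat.cast_nonneg _) (hCnn j)
  rcases Nat.lt_or_ge T 2 with hT | hT
  · -- up to time `1` the regret is at most one maximal cost
    have h1 : costRegret μ σ C π T ≤ ⨆ j, C j := by
      rw [costRegret_eq_sum hπ]
      interval_cases T
      · simpa using hM
      · simpa using integral_cost_le_ciSup hπ hCm le_rfl
    have h2 : (⨆ j, C j) ≤ 2 * N * (⨆ j, C j) * (1 + 1 / (κ * w - 1)) := by
      have : (1 : ℝ) ≤ 2 * N * (1 + 1 / (κ * w - 1)) := by nlinarith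
      nlinarith
    linarith
  · rw [costRegret_eq_explore_add_exploit hπ]
    have hK : MonotoneOn (fun t : ℕ => ⌈w * Real.log t⌉₊) (Set.Ici 1) := by
      intro a ha b _ hab
      have ha' : (0 : ℝ) < a := by exact_mod_cast (Set.mem_Ici.1 ha)
      exact Nat.ceil_mono
        (mul_le_mul_of_nonneg_left (Real.log_le_log ha' (by exact_mod_cast hab)) hw0.le)
    have hKpos : ∀ t : ℕ, 2 ≤ t → 0 < ⌈w * Real.log t⌉₊ := fun t ht =>
      Nat.ceil_pos.2 (mul_pos hw0 (Real.log_pos (by exact_mod_cast ht)))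
    refine add_le_add ?_ ?_
    · rw [← Finset.add_sum_erase _ _ (Finset.mem_univ m), hCm, mul_zero, zero_add]
      refine Finset.sum_le_sum fun j _ => mul_le_mul_of_nonneg_right ?_ (hCnn j)
      exact_mod_cast card_armTimes_le hA hK (by omega) (hKpos T hT) (σ j)
    · have hterm : ∀ t ∈ Finset.Icc 2 T, t ∉ A →
          ∫ ω, C (σ.symm (π t ω)) ∂μ ≤ 2 * N * (⨆ j, C j) * (t : ℝ) ^ (-(κ * w)) := by
        intro t ht htA
        obtain ⟨ht2, -⟩ := Finset.mem_Icc.1 ht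
        have htpos : (0 : ℝ) < t := by exact_mod_cast (by omega : 0 < t)
        have hobs : ∀ n : Fin N, ⌈w * Real.log t⌉₊ ≤ numObs A n t := fun n =>
          le_numObs hA (by omega) htA n
        have hexp : ∀ n, μ.real {ω | δ ≤ |est n t ω - θ n|} ≤ 2 * (t : ℝ) ^ (-(κ * w)) := by
          intro n
          refine (hconc n t ((hKpos t ht2).trans_le (hobs n))).trans ?_
          rw [Real.rpow_def_of_pos htpos]
          have h1 : w * Real.log t ≤ numObs A n t :=
            (Nat.le_ceil _).trans (by exact_mod_cast hobs n)
          have h2 : -κ * numObs A n t ≤ Real.log t * -(κ * w) := by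
            linarith [mul_le_mul_of_nonneg_left h1 hκ.le]
          linarith [Real.exp_le_exp.2 h2]
        calc ∫ ω, C (σ.symm (π t ω)) ∂μ ≤ (⨆ j, C j) * μ.real {ω | π t ω ≠ σ m} :=
              integral_cost_le hπ hCm (by omega)
          _ ≤ (⨆ j, C j) * ∑ n, μ.real {ω | δ ≤ |est n t ω - θ n|} :=
              mul_le_mul_of_nonneg_left (measureReal_wrong_le hσ hg hπ (by omega) htA
                fun n => (hKpos t ht2).trans_le (hobs n)) hM
          _ ≤ (⨆ j, C j) * ∑ _n : Fin N, 2 * (t : ℝ) ^ (-(κ * w)) :=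
              mul_le_mul_of_nonneg_left (Finset.sum_le_sum fun n _ => hexp n) hM
          _ = 2 * N * (⨆ j, C j) * (t : ℝ) ^ (-(κ * w)) := by
              simp; ring
      have hnn : ∀ t ∈ Finset.Icc 1 T, 0 ≤ ∫ ω, C (σ.symm (π t ω)) ∂μ := fun t _ =>
        integral_nonneg fun ω => hCnn _
      have hsplit : Finset.Icc 1 T = insert 1 (Finset.Icc 2 T) := by
        ext s
        simp only [Finset.mem_insert, Finset.mem_Icc]
        omega
      have h1notin : 1 ∉ Finset.Icc 2 T := by simp
      rw [Finset.sum_filter, hsplit, Finset.sum_insert h1notin, mul_add, mul_one]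
      refine add_le_add ?_ ?_
      · have h1 := integral_cost_le_ciSup (μ := μ) (C := C) (σ := σ) hπ hCm (le_refl 1)
        split_ifs
        · positivity
        · nlinarith
      · calc _ ≤ ∑ t ∈ Finset.Icc 2 T, 2 * N * (⨆ j, C j) * (t : ℝ) ^ (-(κ * w)) := by
              refine Finset.sum_le_sum fun t ht => ?_
              split_ifs with htA
              · positivity
              · exact hterm t ht htA
          _ ≤ _ := by
              rw [← Finset.mul_sum]
              exact mul_le_mul_of_nonneg_left (sum_rpow_neg_le hq T) (by positivity)

/-- The regret is at most the maximal cost times the number of explorations plus the expected number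
of wrong exploitations, where the first `t₀` times are not controlled. -/
lemma costRegret_le_card_add_sum (hπ : IsDSEEPolicy A est m π) (hCm : C m = 0) {b : ℕ → ℝ}
    (hb : ∀ t, 0 ≤ b t) {t₀ : ℕ}
    (hwrong : ∀ t, t₀ < t → t ∉ A → μ.real {ω | π t ω ≠ σ m} ≤ b t) (T : ℕ) :
    costRegret μ σ C π T
      ≤ (⨆ j, C j) * ((explUpTo A T).card + (t₀ + ∑ t ∈ Finset.Icc 1 T, b t)) := by
  classical
  have hM := ciSup_cost_nonneg hCm
  rw [costRegret_eq_explore_add_exploit hπ, mul_add]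
  refine add_le_add (sum_card_armTimes_mul_le T) ?_
  have hterm : ∀ t ∈ (Finset.Icc 1 T).filter (· ∉ A), ∫ ω, C (σ.symm (π t ω)) ∂μ
      ≤ (⨆ j, C j) * ((if t ∈ Finset.Icc 1 t₀ then 1 else 0) + b t) := by
    intro t ht
    obtain ⟨ht1, htA⟩ := Finset.mem_filter.1 ht
    have h1 := (Finset.mem_Icc.1 ht1).1
    refine (integral_cost_le hπ hCm h1).trans (mul_le_mul_of_nonneg_left ?_ hM)
    by_cases h : t ≤ t₀
    · rw [if_pos (Finset.mem_Icc.2 ⟨h1, h⟩)]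
      linarith [hb t, measureReal_le_one (μ := μ) (s := {ω | π t ω ≠ σ m})]
    · rw [if_neg (by simp [h]), zero_add]
      exact hwrong t (not_le.1 h) htA
  calc _ ≤ ∑ t ∈ (Finset.Icc 1 T).filter (· ∉ A),
        (⨆ j, C j) * ((if t ∈ Finset.Icc 1 t₀ then 1 else 0) + b t) := Finset.sum_le_sum hterm
    _ ≤ ∑ t ∈ Finset.Icc 1 T, (⨆ j, C j) * ((if t ∈ Finset.Icc 1 t₀ then 1 else 0) + b t) := by
        refine Finset.sum_le_sum_of_subset_of_nonneg (Finset.filter_subset _ _) fun t _ _ => ?_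
        have := hb t
        positivity
    _ ≤ _ := by
        rw [← Finset.mul_sum, Finset.sum_add_distrib]
        refine mul_le_mul_of_nonneg_left (add_le_add ?_ le_rfl) hM
        rw [← Finset.sum_filter, Finset.sum_const, nsmul_eq_mul, mul_one]
        have : ((Finset.Icc 1 T).filter (· ∈ Finset.Icc 1 t₀)).card ≤ (Finset.Icc 1 t₀).card :=
          Finset.card_le_card fun s hs => (Finset.mem_filter.1 hs).2
        rw [Nat.card_Icc, Nat.add_sub_cancel] at this
        exact_mod_cast this

end RegretBounds

/-! ### Sums of independent rewards over a set of times -/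

section Sums

variable {Ω : Type*} [MeasurableSpace Ω] {μ : Measure Ω} {N : ℕ} {X : Fin N → ℕ → Ω → ℝ}

/-- A set of positive times, reindexed from zero as in the independence assumption. -/
lemma exists_map_succ {s : Finset ℕ} (hs : ∀ t ∈ s, 1 ≤ t) :
    ∃ s' : Finset ℕ, s = s'.map ⟨Nat.succ, Nat.succ_injective⟩ := by
  refine ⟨s.image Nat.pred, ?_⟩
  ext t
  simp only [Finset.mem_map, Finset.mem_image, Function.Embedding.coeFn_mk]
  constructor
  · intro ht
    exact ⟨t.pred, ⟨t, ht, rfl⟩, Nat.succ_pred_eq_of_pos (hs t ht)⟩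
  · rintro ⟨_, ⟨r, hr, rfl⟩, rfl⟩
    rwa [Nat.succ_eq_add_one, Nat.pred_eq_sub_one, Nat.sub_add_cancel (hs r hr)]

/-- The sum of the rewards of an arm over any set of times has the law of the sum of its first
rewards. -/
lemma IIDRewards.identDistrib_sum [IsProbabilityMeasure μ] (hX : IIDRewards μ X) (n : Fin N)
    {s : Finset ℕ} (hs : ∀ t ∈ s, 1 ≤ t) :
    IdentDistrib (fun ω => ∑ t ∈ s, X n t ω) (fun ω => ∑ t ∈ Finset.Icc 1 s.card, X n t ω) μ μ := by
  let e : Fin s.card → ℕ := fun i => (s.equivFin.symm i : ℕ)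
  have he1 : ∀ i, 1 ≤ e i := fun i => hs _ (s.equivFin.symm i).2
  have heinj : Function.Injective fun i => e i - 1 := by
    intro i j hij
    have h1 := he1 i
    have h2 := he1 j
    have : e i = e j := by
      simp only at hij
      omega
    exact s.equivFin.symm.injective (Subtype.ext this)
  have hV : iIndepFun (fun i => X n (e i)) μ := by
    have := (hX.indep n).precomp heinj
    simpa only [Nat.sub_add_cancel (he1 _)] using this
  have hW : iIndepFun (fun i : Fin s.card => X n ((i : ℕ) + 1)) μ :=
    (hX.indep n).precomp Fin.val_injective
  have hid : ∀ i : Fin s.card, IdentDistrib (X n (e i)) (X n ((i : ℕ) + 1)) μ μ := fun i =>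
    (hX.identDistrib n _ (he1 i)).trans (hX.identDistrib n _ (by omega)).symm
  have key := (IdentDistrib.pi hid hV hW).comp
    (u := fun x : Fin s.card → ℝ => ∑ i, x i) (by fun_prop)
  have h1 : (fun ω => ∑ t ∈ s, X n t ω) = fun ω => ∑ i, X n (e i) ω := by
    funext ω
    rw [← Finset.sum_coe_sort s fun t => X n t ω]
    exact (Equiv.sum_comp s.equivFin.symm fun t : s => X n t ω).symm
  have h2 : (fun ω => ∑ t ∈ Finset.Icc 1 s.card, X n t ω)
      = fun ω => ∑ i : Fin s.card, X n ((i : ℕ) + 1) ω := by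
    funext ω
    rw [Fin.sum_univ_eq_sum_range (fun i => X n (i + 1) ω), Finset.range_eq_Ico,
      Finset.sum_Ico_add' (fun i => X n i ω) 0 s.card 1]
    rfl
  rw [h1, h2]
  exact key

end Sums

/-! ### Exponential concentration for light tails -/

lemma Ioo_subset_interior_integrableExpSet {Ω : Type*} [MeasurableSpace Ω] {μ : Measure Ω}
    {Y : Ω → ℝ} {u₀ : ℝ}
    (hint : ∀ u : ℝ, |u| ≤ u₀ → Integrable (fun ω => Real.exp (u * Y ω)) μ) :
    Set.Ioo (-u₀) u₀ ⊆ interior (integrableExpSet Y μ) :=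
  interior_maximal (fun u hu => hint u (abs_le.2 ⟨hu.1.le, hu.2.le⟩)) isOpen_Ioo

/-- Light-tailed rewards have moment-generating functions with a bounded second derivative near
zero. -/
lemma exists_lightTailConstants {Ω : Type*} [MeasurableSpace Ω] {μ : Measure Ω} {N : ℕ}
    {X : Fin N → ℕ → Ω → ℝ} (h : ∀ n, LightTailed μ (X n 1)) :
    ∃ ζ u₀ : ℝ, 0 < ζ ∧ 0 < u₀ ∧ LightTailConstants μ X ζ u₀ := by
  let Y : Fin N → Ω → ℝ := fun n ω => X n 1 ω - mean μ X n
  have hY : ∀ n, ∃ v : ℝ, 0 < v ∧ ∀ u : ℝ, |u| ≤ v →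
      Integrable (fun ω => Real.exp (u * Y n ω)) μ := by
    intro n
    obtain ⟨v, hv, hint⟩ := h n
    refine ⟨v, hv, fun u hu => ?_⟩
    have : (fun ω => Real.exp (u * Y n ω))
        = fun ω => Real.exp (-(u * mean μ X n)) * Real.exp (u * X n 1 ω) := by
      funext ω
      rw [← Real.exp_add]
      congr 1
      ring
    rw [this]
    exact (hint u hu).const_mul _
  have hev : ∀ n, ∀ᶠ u in nhds (0 : ℝ), Integrable (fun ω => Real.exp (u * Y n ω)) μ ∧
      iteratedDeriv 2 (mgf (Y n) μ) u ≤ ∑ k, |iteratedDeriv 2 (mgf (Y k) μ) 0| + 1 := by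
    intro n
    obtain ⟨v, hv, hint⟩ := hY n
    have hIoo : Set.Ioo (-v) v ∈ nhds (0 : ℝ) := Ioo_mem_nhds (by linarith) hv
    have h0 : (0 : ℝ) ∈ interior (integrableExpSet (Y n) μ) :=
      Ioo_subset_interior_integrableExpSet hint ⟨by linarith, hv⟩
    have hcont : ContinuousAt (iteratedDeriv 2 (mgf (Y n) μ)) 0 :=
      (analyticOnNhd_mgf.iterated_deriv 2 0 h0).continuousAt.congr
        (Eventually.of_forall fun u => by rw [iteratedDeriv_eq_iterate])
    have hlt : iteratedDeriv 2 (mgf (Y n) μ) 0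
        < ∑ k, |iteratedDeriv 2 (mgf (Y k) μ) 0| + 1 := by
      have := Finset.single_le_sum (f := fun k => |iteratedDeriv 2 (mgf (Y k) μ) 0|)
        (fun k _ => abs_nonneg _) (Finset.mem_univ n)
      have h2 := le_abs_self (iteratedDeriv 2 (mgf (Y n) μ) 0)
      linarith
    filter_upwards [hIoo, hcont.eventually_lt_const hlt] with u hu hu2
    exact ⟨hint u (abs_le.2 ⟨hu.1.le, hu.2.le⟩), hu2.le⟩
  obtain ⟨ε, hε, hball⟩ := Metric.eventually_nhds_iff.1 (Filter.eventually_all.2 hev)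
  refine ⟨∑ k, |iteratedDeriv 2 (mgf (Y k) μ) 0| + 1, ε / 2, ?_, by linarith, fun n => ⟨?_, ?_⟩⟩
  · have : 0 ≤ ∑ k, |iteratedDeriv 2 (mgf (Y k) μ) 0| := Finset.sum_nonneg fun _ _ => abs_nonneg _
    linarith
  · intro u hu
    exact (hball (y := u) (by rw [Real.dist_0_eq_abs]; linarith) n).1
  · intro u hu
    exact (hball (y := u) (by rw [Real.dist_0_eq_abs]; linarith) n).2

section LightTails

variable {Ω : Type*} [MeasurableSpace Ω] {μ : Measure Ω} [IsProbabilityMeasure μ]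

/-- Chernoff's bound for a sum of independent random variables. -/
lemma measureReal_le_sum_le_exp {ι : Type*} {Y : ι → Ω → ℝ} (hY : iIndepFun Y μ)
    (hmeas : ∀ i, Measurable (Y i)) {s : Finset ι} {u x : ℝ} {v : ι → ℝ} (hu : 0 ≤ u)
    (hint : ∀ i ∈ s, Integrable (fun ω => Real.exp (u * Y i ω)) μ)
    (hv : ∀ i ∈ s, mgf (Y i) μ u ≤ Real.exp (v i)) :
    μ.real {ω | x ≤ ∑ i ∈ s, Y i ω} ≤ Real.exp (-u * x + ∑ i ∈ s, v i) := by
  have h1 := measure_ge_le_exp_mul_mgf (X := ∑ i ∈ s, Y i) x hu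
    (hY.integrable_exp_mul_sum hmeas hint)
  simp only [Finset.sum_apply] at h1
  refine h1.trans ?_
  rw [Real.exp_add, Real.exp_sum, hY.mgf_sum hmeas]
  exact mul_le_mul_of_nonneg_left (Finset.prod_le_prod (fun _ _ => mgf_nonneg) hv)
    (Real.exp_nonneg _)

lemma measureReal_le_abs_le {Z : Ω → ℝ} {x b : ℝ} (h1 : μ.real {ω | x ≤ Z ω} ≤ b)
    (h2 : μ.real {ω | x ≤ -Z ω} ≤ b) : μ.real {ω | x ≤ |Z ω|} ≤ 2 * b := by
  calc μ.real {ω | x ≤ |Z ω|} ≤ μ.real ({ω | x ≤ Z ω} ∪ {ω | x ≤ -Z ω}) := by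
        refine measureReal_mono ?_ (measure_ne_top _ _)
        intro ω hω
        rw [Set.mem_ofPred_eq] at hω
        exact le_abs.1 hω
    _ ≤ μ.real {ω | x ≤ Z ω} + μ.real {ω | x ≤ -Z ω} := measureReal_union_le _ _
    _ ≤ 2 * b := by linarith

/-- A bound on the second derivative of the moment-generating function of a centred random variable
makes it subgaussian near zero. -/
lemma mgf_le_exp_of_iteratedDeriv_le {Y : Ω → ℝ} {ζ u₀ : ℝ}
    (hint : ∀ u : ℝ, |u| ≤ u₀ → Integrable (fun ω => Real.exp (u * Y ω)) μ)
    (hζ : ∀ u : ℝ, |u| < u₀ → iteratedDeriv 2 (mgf Y μ) u ≤ ζ) (hY : ∫ ω, Y ω ∂μ = 0)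
    {u : ℝ} (hu : |u| < u₀) : mgf Y μ u ≤ Real.exp (ζ * u ^ 2 / 2) := by
  have hsub := Ioo_subset_interior_integrableExpSet hint
  have hu' := abs_lt.1 hu
  have h0 : (0 : ℝ) ∈ interior (integrableExpSet Y μ) := hsub ⟨by linarith, by linarith⟩
  rcases eq_or_ne u 0 with rfl | hne
  · simp
  have huIcc : Set.uIcc 0 u ⊆ Set.Ioo (-u₀) u₀ := by
    intro x hx
    rcases Set.mem_uIcc.1 hx with h | h <;> exact ⟨by linarith, by linarith⟩
  have hud : UniqueDiffOn ℝ (Set.uIcc 0 u) := uniqueDiffOn_Icc (by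
    rcases lt_or_gt_of_ne hne with h | h <;> simp [h])
  have hcd : ContDiffOn ℝ (((1 : ℕ) : WithTop ℕ∞) + 1) (mgf Y μ) (Set.uIcc 0 u) :=
    (analyticOnNhd_mgf.mono (huIcc.trans hsub)).contDiffOn hud
  obtain ⟨x, hx, hxeq⟩ := taylor_mean_remainder_lagrange_iteratedDeriv hne.symm hcd
  have hderiv : derivWithin (mgf Y μ) (Set.uIcc 0 u) 0 = 0 := by
    rw [(analyticAt_mgf h0).differentiableAt.derivWithin (hud 0 Set.left_mem_uIcc),
      deriv_mgf_zero h0, hY]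
  have hT : taylorWithinEval (mgf Y μ) 1 (Set.uIcc 0 u) 0 u = 1 := by
    simp [taylorWithinEval_succ, hderiv]
  have hxle : iteratedDeriv 2 (mgf Y μ) x ≤ ζ := by
    have := huIcc (Set.uIoo_subset_uIcc_self hx)
    exact hζ x (abs_lt.2 this)
  have h1 : mgf Y μ u = 1 + iteratedDeriv 2 (mgf Y μ) x * u ^ 2 / 2 := by
    rw [hT] at hxeq
    norm_num at hxeq
    linarith
  have h2 := Real.add_one_le_exp (ζ * u ^ 2 / 2)
  have h3 := mul_le_mul_of_nonneg_right hxle (sq_nonneg u)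
  linarith

variable {N : ℕ} {X : Fin N → ℕ → Ω → ℝ}

/-- The one-sided Chernoff–Hoeffding inequality; `Y` is an independent family of centred variables
that have a common law. -/
lemma measureReal_le_sum_of_iteratedDeriv_le {Y : ℕ → Ω → ℝ} (hY : iIndepFun Y μ)
    (hmeas : ∀ i, Measurable (Y i)) (hid : ∀ i, IdentDistrib (Y i) (Y 0) μ μ) {ζ u₀ : ℝ}
    (hζ0 : 0 < ζ)
    (hint : ∀ u : ℝ, |u| ≤ u₀ → Integrable (fun ω => Real.exp (u * Y 0 ω)) μ)
    (hζ : ∀ u : ℝ, |u| < u₀ → iteratedDeriv 2 (mgf (Y 0) μ) u ≤ ζ) (hY0 : ∫ ω, Y 0 ω ∂μ = 0)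
    (s : ℕ) {η : ℝ} (hη : 0 ≤ η) (hη1 : η ≤ ζ * u₀) :
    μ.real {ω | s * η ≤ ∑ i ∈ Finset.range s, Y i ω} ≤ Real.exp (-(1 / (2 * ζ)) * η ^ 2 * s) := by
  have hle : ∀ u, 0 ≤ u → u < u₀ → μ.real {ω | s * η ≤ ∑ i ∈ Finset.range s, Y i ω}
      ≤ Real.exp (-u * (s * η) + s * (ζ * u ^ 2 / 2)) := by
    intro u hu huu
    have habs : |u| < u₀ := by rwa [abs_of_nonneg hu]
    have := measureReal_le_sum_le_exp (μ := μ) hY hmeas (s := Finset.range s) (x := s * η) hu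
      (v := fun _ => ζ * u ^ 2 / 2) (fun i _ =>
        ((hid i).comp (u := fun y => Real.exp (u * y)) (by fun_prop)).integrable_iff.2
          (hint u habs.le))
      (fun i _ => by
        rw [mgf_congr_identDistrib (hid i)]
        exact mgf_le_exp_of_iteratedDeriv_le hint hζ hY0 habs)
    simpa using this
  have hval : -(η / ζ) * (s * η) + s * (ζ * (η / ζ) ^ 2 / 2) = -(1 / (2 * ζ)) * η ^ 2 * s := by
    field_simp
    ring
  rw [← hval]
  rcases hη.eq_or_lt with rfl | hpos
  · simp
  -- the optimal `u = η / ζ` may be the end point `u₀`, which is reached as a limit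
  have hpos' : 0 < η / ζ := div_pos hpos hζ0
  have hle0 : η / ζ ≤ u₀ := by rwa [div_le_iff₀' hζ0]
  have hlim : Tendsto (fun u : ℝ => Real.exp (-u * (s * η) + s * (ζ * u ^ 2 / 2)))
      (nhdsWithin (η / ζ) (Set.Iio (η / ζ)))
      (nhds (Real.exp (-(η / ζ) * (s * η) + s * (ζ * (η / ζ) ^ 2 / 2)))) := by
    refine Tendsto.mono_left (Continuous.tendsto ?_ _) nhdsWithin_le_nhds
    fun_prop
  refine ge_of_tendsto hlim ?_
  filter_upwards [Ioo_mem_nhdsLT hpos'] with u hu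
  exact hle u hu.1.le (hu.2.trans_le hle0)

/-- Bounds on the moment-generating functions of the rewards imply the Chernoff–Hoeffding
inequality. -/
theorem chernoffHoeffding_of_lightTailConstants (hX : IIDRewards μ X) {a ζ u₀ : ℝ} (hζ : 0 < ζ)
    (ha : a ≤ 1 / (2 * ζ)) (h : LightTailConstants μ X ζ u₀) : ChernoffHoeffding μ X a ζ u₀ := by
  intro n s η hs hη hη1
  obtain ⟨hint, hder⟩ := h n
  set θ := mean μ X n with hθ
  let Y : ℕ → Ω → ℝ := fun i ω => X n (i + 1) ω - θ
  have hYind : iIndepFun Y μ := (hX.indep n).comp (fun _ x => x - θ) fun _ => by fun_prop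
  have hYmeas : ∀ i, Measurable (Y i) := fun i => (hX.measurable n (i + 1) (by omega)).sub_const θ
  have hYid : ∀ i, IdentDistrib (Y i) (Y 0) μ μ := fun i =>
    (hX.identDistrib n (i + 1) (by omega)).comp (u := fun x => x - θ) (by fun_prop)
  have hY0 : ∫ ω, Y 0 ω ∂μ = 0 := by
    have : ∫ ω, Y 0 ω ∂μ = ∫ ω, X n 1 ω ∂μ - θ := by
      simp only [Y, zero_add]
      rw [integral_sub (hX.integrable n) (integrable_const _)]
      simp
    rw [this, hθ, mean, sub_self]
  have hs0 : (0 : ℝ) < s := by exact_mod_cast hs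
  have hsum : ∀ ω, ∑ i ∈ Finset.range s, Y i ω
      = s * ((∑ t ∈ Finset.Icc 1 s, X n t ω) / s - θ) := by
    intro ω
    have : ∑ t ∈ Finset.Icc 1 s, X n t ω = ∑ i ∈ Finset.range s, X n (i + 1) ω := by
      rw [Finset.range_eq_Ico, Finset.sum_Ico_add' (fun i => X n i ω) 0 s 1]
      rfl
    rw [this]
    simp only [Y, Finset.sum_sub_distrib, Finset.sum_const, Finset.card_range, nsmul_eq_mul]
    field_simp
  have hup := measureReal_le_sum_of_iteratedDeriv_le hYind hYmeas hYid hζ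
    (by simpa only [Y, zero_add] using hint) (by simpa only [Y, zero_add] using hder) hY0 s hη hη1
  have hmgfneg : mgf (fun ω => -Y 0 ω) μ = fun u => mgf (Y 0) μ (-u) := by
    funext u
    exact mgf_neg
  have hlow := measureReal_le_sum_of_iteratedDeriv_le (μ := μ) (Y := fun i ω => -Y i ω)
    (hYind.comp (fun _ x => -x) fun _ => measurable_neg) (fun i => (hYmeas i).neg)
    (fun i => (hYid i).comp (u := fun x => -x) measurable_neg) (ζ := ζ) (u₀ := u₀) hζ
    (fun u hu => by
      have := hint (-u) (by rwa [abs_neg])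
      simpa only [Y, zero_add, mul_neg, neg_mul] using this)
    (fun u hu => by
      rw [hmgfneg, iteratedDeriv_comp_neg]
      have := hder (-u) (by rwa [abs_neg])
      simpa [Y] using this)
    (by rw [integral_neg, hY0, neg_zero]) s hη hη1
  have hset : {ω | η ≤ |(∑ t ∈ Finset.Icc 1 s, X n t ω) / s - θ|}
      = {ω | s * η ≤ |∑ i ∈ Finset.range s, Y i ω|} := by
    ext ω
    simp only [Set.mem_ofPred_eq, hsum, abs_mul, abs_of_pos hs0, mul_le_mul_iff_right₀ hs0]
  rw [hset]
  simp only [Finset.sum_neg_distrib] at hlow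
  refine (measureReal_le_abs_le hup hlow).trans ?_
  gcongr

/-- The Chernoff–Hoeffding inequality carries over from the first rewards of an arm to the
observations made during exploration, whose times are not random. -/
lemma measureReal_sampleMean_le (hX : IIDRewards μ X) {a ζ u₀ : ℝ}
    (h : ChernoffHoeffding μ X a ζ u₀) {A : Set ℕ} (n : Fin N) {t : ℕ} (ht : 0 < numObs A n t)
    {δ : ℝ} (hδ : 0 ≤ δ) (hδ1 : δ ≤ ζ * u₀) :
    μ.real {ω | δ ≤ |sampleMean X A n t ω - mean μ X n|}
      ≤ 2 * Real.exp (-(a * δ ^ 2) * numObs A n t) := by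
  have hid := hX.identDistrib_sum n (s := armTimes A n (t - 1)) fun r hr =>
    one_le_of_mem_armTimes hr
  have hB : MeasurableSet {x : ℝ | δ ≤ |x / numObs A n t - mean μ X n|} :=
    measurableSet_le measurable_const (by fun_prop)
  have h1 := hid.measure_mem_eq hB
  have h2 := h n (numObs A n t) δ ht hδ hδ1
  rw [← neg_mul] at *
  refine le_trans (le_of_eq ?_) h2
  exact congrArg ENNReal.toReal h1

end LightTails

/-! ### Moments of sums of independent random variables -/

lemma abs_rpow_eq_abs_rpow_sub_two_mul_sq {x : ℝ} (hx : x ≠ 0) (p : ℝ) :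
    |x| ^ p = |x| ^ (p - 2) * x ^ 2 := by
  rw [← sq_abs, ← Real.rpow_natCast, ← Real.rpow_add (abs_pos.2 hx)]
  congr 1
  push_cast
  ring

/-- A Taylor bound for `|x| ^ p`, which follows from `1 + z ≤ exp z`. -/
lemma abs_add_rpow_le_of_mul_abs_le {p : ℝ} (hp : 1 < p) {x y : ℝ} (h : p * |y| ≤ |x|) :
    |x + y| ^ p ≤ |x| ^ p + p * (|x| ^ (p - 2) * x * y) + p ^ 2 * (|x| ^ (p - 2) * y ^ 2) := by
  rcases eq_or_ne x 0 with rfl | hx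
  · have hy : y = 0 := by
      rw [abs_zero] at h
      by_contra hy
      have := mul_pos (by linarith : 0 < p) (abs_pos.2 hy)
      linarith
    simp [hy]
  have hx' := abs_pos.2 hx
  set z := y / x with hz
  have hyz : y = x * z := by rw [hz]; field_simp
  have hpz : |p * z| ≤ 1 := by
    rw [hz, abs_mul, abs_div, abs_of_pos (by linarith : 0 < p), ← mul_div_assoc,
      div_le_one hx']
    exact h
  have h1z : 0 ≤ 1 + z := by
    have h1 := (abs_le.1 hpz).1
    by_contra hneg
    push Not at hneg
    nlinarith
  have h1 : (1 + z) ^ p ≤ 1 + p * z + (p * z) ^ 2 := by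
    calc (1 + z) ^ p ≤ Real.exp z ^ p :=
          Real.rpow_le_rpow h1z (by linarith [Real.add_one_le_exp z]) (by linarith)
      _ = Real.exp (p * z) := by rw [← Real.exp_mul, mul_comm]
      _ ≤ _ := by
          have := (abs_le.1 (Real.abs_exp_sub_one_sub_id_le hpz)).2
          linarith
  have h2 : |x + y| ^ p = |x| ^ p * (1 + z) ^ p := by
    rw [← Real.mul_rpow hx'.le h1z, hyz]
    congr 1
    rw [show x + x * z = x * (1 + z) by ring, abs_mul, abs_of_nonneg h1z]
  rw [h2]
  refine (mul_le_mul_of_nonneg_left h1 (by positivity)).trans (le_of_eq ?_)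
  rw [hyz, abs_rpow_eq_abs_rpow_sub_two_mul_sq hx]
  ring

lemma abs_add_rpow_le_of_le_mul_abs {p : ℝ} (hp : 1 < p) {x y : ℝ} (h : |x| ≤ p * |y|) :
    |x + y| ^ p ≤ |x| ^ p + p * (|x| ^ (p - 2) * x * y) + ((1 + p) ^ p + p ^ p) * |y| ^ p := by
  have hp0 : 0 < p := by linarith
  have h1 : |x + y| ^ p ≤ (1 + p) ^ p * |y| ^ p := by
    rw [← Real.mul_rpow (by linarith) (abs_nonneg _)]
    refine Real.rpow_le_rpow (abs_nonneg _) ?_ hp0.le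
    have := abs_add_le x y
    linarith
  have h2 : -(p ^ p * |y| ^ p) ≤ p * (|x| ^ (p - 2) * x * y) := by
    rcases eq_or_ne x 0 with rfl | hx
    · have : 0 ≤ p ^ p * |y| ^ p := by positivity
      simpa using this
    · have hx' := abs_pos.2 hx
      have hy' : 0 < |y| := by
        by_contra hy
        have : |y| = 0 := le_antisymm (not_lt.1 hy) (abs_nonneg _)
        rw [this] at h
        linarith
      have h3 : |p * (|x| ^ (p - 2) * x * y)| ≤ p ^ p * |y| ^ p := by
        have h4 : |p * (|x| ^ (p - 2) * x * y)| = p * |x| ^ (p - 1) * |y| := by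
          rw [abs_mul, abs_mul, abs_mul, abs_of_pos hp0,
            abs_of_nonneg (Real.rpow_nonneg (abs_nonneg x) _),
            show p - 1 = (p - 2) + 1 by ring, Real.rpow_add_one hx'.ne']
          ring
        have h5 : |x| ^ (p - 1) ≤ (p * |y|) ^ (p - 1) :=
          Real.rpow_le_rpow hx'.le h (by linarith)
        rw [h4]
        calc p * |x| ^ (p - 1) * |y| ≤ p * (p * |y|) ^ (p - 1) * |y| := by gcongr
          _ = p ^ p * |y| ^ p := by
            rw [Real.mul_rpow hp0.le hy'.le, Real.rpow_sub_one hp0.ne', Real.rpow_sub_one hy'.ne']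
            field_simp
      exact (abs_le.1 h3).1
  have h3 : 0 ≤ |x| ^ p := by positivity
  linarith

lemma sq_le_one_add_rpow_add {p : ℝ} (hp : 1 < p) : p ^ 2 ≤ (1 + p) ^ p + p ^ p := by
  have h1 := one_add_mul_self_le_rpow_one_add (s := p) (by linarith) hp.le
  have h2 : 0 ≤ p ^ p := by positivity
  nlinarith

lemma abs_add_rpow_le {p : ℝ} (hp : 1 < p) (x y : ℝ) :
    |x + y| ^ p ≤ |x| ^ p + p * (|x| ^ (p - 2) * x * y)
      + ((1 + p) ^ p + p ^ p) * (|x| ^ (p - 2) * y ^ 2 + |y| ^ p) := by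
  have hc := sq_le_one_add_rpow_add hp
  have hc0 : 0 ≤ (1 + p) ^ p + p ^ p := (sq_nonneg p).trans hc
  have h1 : 0 ≤ |x| ^ (p - 2) * y ^ 2 := by positivity
  have h2 : 0 ≤ |y| ^ p := by positivity
  rcases le_total (p * |y|) |x| with h | h
  · have := abs_add_rpow_le_of_mul_abs_le hp h
    nlinarith [mul_le_mul_of_nonneg_right hc h1, mul_nonneg hc0 h2]
  · have := abs_add_rpow_le_of_le_mul_abs hp h
    nlinarith [mul_nonneg hc0 h1]

lemma abs_add_rpow_le_of_le_two {p : ℝ} (hp : 1 < p) (hp2 : p ≤ 2) (x y : ℝ) :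
    |x + y| ^ p ≤ |x| ^ p + p * (|x| ^ (p - 2) * x * y)
      + ((1 + p) ^ p + p ^ p) * |y| ^ p := by
  rcases le_total (p * |y|) |x| with h | h
  · refine (abs_add_rpow_le_of_mul_abs_le hp h).trans ?_
    have hc := sq_le_one_add_rpow_add hp
    have h1 : |x| ^ (p - 2) * y ^ 2 ≤ |y| ^ p := by
      rcases eq_or_ne y 0 with rfl | hy
      · simp
        positivity
      · rw [abs_rpow_eq_abs_rpow_sub_two_mul_sq hy]
        have hy' := abs_pos.2 hy
        refine mul_le_mul_of_nonneg_right ?_ (sq_nonneg y)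
        exact Real.rpow_le_rpow_of_nonpos hy' (by nlinarith) (by linarith)
    have h2 : 0 ≤ |y| ^ p := by positivity
    nlinarith [mul_le_mul_of_nonneg_right hc h2, mul_le_mul_of_nonneg_left h1 (sq_nonneg p)]
  · exact abs_add_rpow_le_of_le_mul_abs hp h

section Moments

variable {Ω : Type*} [MeasurableSpace Ω] {μ : Measure Ω}

lemma integrable_abs_rpow_of_memLp [IsFiniteMeasure μ] {p q : ℝ} {S : Ω → ℝ}
    (hS : MemLp S (ENNReal.ofReal p) μ) (hq : 0 ≤ q) (hqp : q ≤ p) :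
    Integrable (fun ω => |S ω| ^ q) μ := by
  have := (hS.mono_exponent (ENNReal.ofReal_le_ofReal hqp)).integrable_norm_rpow'
  simpa [ENNReal.toReal_ofReal hq, Real.norm_eq_abs] using this

lemma integrable_abs_rpow_sub_two_mul_self [IsFiniteMeasure μ] {p : ℝ} (hp : 1 < p) {S : Ω → ℝ}
    (hSm : Measurable S) (hS : MemLp S (ENNReal.ofReal p) μ) :
    Integrable (fun ω => |S ω| ^ (p - 2) * S ω) μ := by
  refine (integrable_abs_rpow_of_memLp hS (q := p - 1) (by linarith) (by linarith)).mono'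
    (by fun_prop) (Eventually.of_forall fun ω => ?_)
  rcases eq_or_ne (S ω) 0 with h | h
  · simp [h, Real.zero_rpow (by linarith : p - 1 ≠ 0)]
  · rw [Real.norm_eq_abs, abs_mul, abs_of_nonneg (Real.rpow_nonneg (abs_nonneg _) _),
      show p - 1 = (p - 2) + 1 by ring, Real.rpow_add_one (abs_pos.2 h).ne']

variable [IsProbabilityMeasure μ]

lemma integral_abs_add_rpow_le_of_le_two {p : ℝ} (hp : 1 < p) (hp2 : p ≤ 2) {S Y : Ω → ℝ}
    (hSm : Measurable S) (hS : MemLp S (ENNReal.ofReal p) μ)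
    (hY : MemLp Y (ENNReal.ofReal p) μ) (hind : IndepFun S Y μ) (hY0 : ∫ ω, Y ω ∂μ = 0) :
    ∫ ω, |S ω + Y ω| ^ p ∂μ
      ≤ ∫ ω, |S ω| ^ p ∂μ + ((1 + p) ^ p + p ^ p) * ∫ ω, |Y ω| ^ p ∂μ := by
  have hψ := integrable_abs_rpow_sub_two_mul_self hp hSm hS
  have hYi : Integrable Y μ := hY.integrable (ENNReal.one_le_ofReal.2 hp.le)
  have hind' : IndepFun (fun ω => |S ω| ^ (p - 2) * S ω) Y μ :=
    hind.comp (φ := fun x : ℝ => |x| ^ (p - 2) * x) (by fun_prop) measurable_id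
  have hcross : Integrable (fun ω => |S ω| ^ (p - 2) * S ω * Y ω) μ :=
    hind'.integrable_mul hψ hYi
  -- the cross term vanishes since `Y` is centred and independent of `S`
  have hzero : ∫ ω, |S ω| ^ (p - 2) * S ω * Y ω ∂μ = 0 := by
    rw [hind'.integral_fun_mul_eq_mul_integral hψ.aestronglyMeasurable hYi.aestronglyMeasurable,
      hY0, mul_zero]
  have hSp := integrable_abs_rpow_of_memLp hS (q := p) (by linarith) le_rfl
  have hYp := integrable_abs_rpow_of_memLp hY (q := p) (by linarith) le_rfl
  have hSY := integrable_abs_rpow_of_memLp (hS.add hY) (q := p) (by linarith) le_rfl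
  have hlin : Integrable (fun ω => |S ω| ^ p + p * (|S ω| ^ (p - 2) * S ω * Y ω)) μ :=
    hSp.add (hcross.const_mul p)
  calc ∫ ω, |S ω + Y ω| ^ p ∂μ
      ≤ ∫ ω, (|S ω| ^ p + p * (|S ω| ^ (p - 2) * S ω * Y ω)
        + ((1 + p) ^ p + p ^ p) * |Y ω| ^ p) ∂μ :=
        integral_mono hSY (hlin.add (hYp.const_mul _))
          fun ω => abs_add_rpow_le_of_le_two hp hp2 (S ω) (Y ω)
    _ = _ := by
        rw [integral_add hlin (hYp.const_mul _),
          integral_add hSp (hcross.const_mul p), integral_const_mul, integral_const_mul, hzero]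
        ring

lemma integral_abs_add_rpow_le {p : ℝ} (hp : 2 < p) {S Y : Ω → ℝ}
    (hSm : Measurable S) (hS : MemLp S (ENNReal.ofReal p) μ)
    (hY : MemLp Y (ENNReal.ofReal p) μ) (hind : IndepFun S Y μ) (hY0 : ∫ ω, Y ω ∂μ = 0) :
    ∫ ω, |S ω + Y ω| ^ p ∂μ
      ≤ ∫ ω, |S ω| ^ p ∂μ + ((1 + p) ^ p + p ^ p)
        * ((∫ ω, |S ω| ^ (p - 2) ∂μ) * ∫ ω, Y ω ^ 2 ∂μ + ∫ ω, |Y ω| ^ p ∂μ) := by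
  have hp1 : 1 < p := by linarith
  have hψ := integrable_abs_rpow_sub_two_mul_self hp1 hSm hS
  have hYi : Integrable Y μ := hY.integrable (ENNReal.one_le_ofReal.2 hp1.le)
  have hind' : IndepFun (fun ω => |S ω| ^ (p - 2) * S ω) Y μ :=
    hind.comp (φ := fun x : ℝ => |x| ^ (p - 2) * x) (by fun_prop) measurable_id
  have hcross : Integrable (fun ω => |S ω| ^ (p - 2) * S ω * Y ω) μ :=
    hind'.integrable_mul hψ hYi
  have hzero : ∫ ω, |S ω| ^ (p - 2) * S ω * Y ω ∂μ = 0 := by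
    rw [hind'.integral_fun_mul_eq_mul_integral hψ.aestronglyMeasurable hYi.aestronglyMeasurable,
      hY0, mul_zero]
  have hind2 : IndepFun (fun ω => |S ω| ^ (p - 2)) (fun ω => Y ω ^ 2) μ :=
    hind.comp (φ := fun x : ℝ => |x| ^ (p - 2)) (ψ := fun y : ℝ => y ^ 2) (by fun_prop)
      (by fun_prop)
  have hS2 := integrable_abs_rpow_of_memLp hS (q := p - 2) (by linarith) (by linarith)
  have hY2 : Integrable (fun ω => Y ω ^ 2) μ := by
    have := integrable_abs_rpow_of_memLp hY (q := (2 : ℕ)) (by norm_num) (by norm_num; linarith)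
    simpa only [Real.rpow_natCast, sq_abs] using this
  have hmix : Integrable (fun ω => |S ω| ^ (p - 2) * Y ω ^ 2) μ := hind2.integrable_mul hS2 hY2
  have hmixval := hind2.integral_fun_mul_eq_mul_integral hS2.aestronglyMeasurable
    hY2.aestronglyMeasurable
  have hSp := integrable_abs_rpow_of_memLp hS (q := p) (by linarith) le_rfl
  have hYp := integrable_abs_rpow_of_memLp hY (q := p) (by linarith) le_rfl
  have hSY := integrable_abs_rpow_of_memLp (hS.add hY) (q := p) (by linarith) le_rfl
  have hlin : Integrable (fun ω => |S ω| ^ p + p * (|S ω| ^ (p - 2) * S ω * Y ω)) μ :=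
    hSp.add (hcross.const_mul p)
  have hmix2 : Integrable (fun ω => |S ω| ^ (p - 2) * Y ω ^ 2 + |Y ω| ^ p) μ := hmix.add hYp
  calc ∫ ω, |S ω + Y ω| ^ p ∂μ
      ≤ ∫ ω, (|S ω| ^ p + p * (|S ω| ^ (p - 2) * S ω * Y ω)
        + ((1 + p) ^ p + p ^ p) * (|S ω| ^ (p - 2) * Y ω ^ 2 + |Y ω| ^ p)) ∂μ :=
        integral_mono hSY (hlin.add (hmix2.const_mul _))
          fun ω => abs_add_rpow_le hp1 (S ω) (Y ω)
    _ = _ := by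
        rw [integral_add hlin (hmix2.const_mul _),
          integral_add hSp (hcross.const_mul p), integral_const_mul, integral_const_mul, hzero,
          integral_add hmix hYp, hmixval]
        ring

/-- An interpolation that replaces Lyapunov's inequality; `ρ` is a free scale. -/
lemma abs_rpow_sub_two_le {p ρ : ℝ} (hp : 2 < p) (hρ : 0 < ρ) (x : ℝ) :
    |x| ^ (p - 2) ≤ ρ ^ (p / 2 - 1) + |x| ^ p / ρ := by
  have h1 : 0 ≤ |x| ^ p / ρ := by positivity
  have h2 : 0 ≤ ρ ^ (p / 2 - 1) := by positivity
  rcases le_total (x ^ 2) ρ with h | h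
  · have : |x| ^ (p - 2) = (x ^ 2) ^ (p / 2 - 1) := by
      rw [← sq_abs, ← Real.rpow_natCast, ← Real.rpow_mul (abs_nonneg _)]
      congr 1
      push_cast
      ring
    have := Real.rpow_le_rpow (sq_nonneg x) h (by linarith : 0 ≤ p / 2 - 1)
    linarith
  · have hx : x ≠ 0 := by
      rintro rfl
      norm_num at h
      linarith
    have : |x| ^ (p - 2) ≤ |x| ^ p / ρ := by
      rw [le_div_iff₀ hρ, abs_rpow_eq_abs_rpow_sub_two_mul_sq hx p]
      exact mul_le_mul_of_nonneg_left h (by positivity)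
    linarith

/-- A weak form of the inequalities of von Bahr–Esseen (`p ≤ 2`) and Marcinkiewicz–Zygmund
(`p > 2`): the growth of the `p`-th absolute moment of a sum of i.i.d. centred variables. -/
theorem exists_integral_abs_sum_rpow_le {p : ℝ} (hp : 1 < p) {Y : ℕ → Ω → ℝ} (hY : iIndepFun Y μ)
    (hmeas : ∀ i, Measurable (Y i)) (hid : ∀ i, IdentDistrib (Y i) (Y 0) μ μ)
    (hLp : MemLp (Y 0) (ENNReal.ofReal p) μ) (hY0 : ∫ ω, Y 0 ω ∂μ = 0) :
    ∃ B : ℝ, 0 ≤ B ∧ ∀ s : Finset ℕ, ∫ ω, |∑ i ∈ s, Y i ω| ^ p ∂μ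
      ≤ B * (s.card : ℝ) ^ (max 1 (p / 2)) := by
  have hLpi : ∀ i, MemLp (Y i) (ENNReal.ofReal p) μ := fun i => (hid i).memLp_iff.2 hLp
  have hY0i : ∀ i, ∫ ω, Y i ω ∂μ = 0 := fun i => by rw [(hid i).integral_eq, hY0]
  have hmom : ∀ i, ∫ ω, |Y i ω| ^ p ∂μ = ∫ ω, |Y 0 ω| ^ p ∂μ := fun i =>
    ((hid i).comp (u := fun x : ℝ => |x| ^ p) (by fun_prop)).integral_eq
  have hmom2 : ∀ i, ∫ ω, Y i ω ^ 2 ∂μ = ∫ ω, Y 0 ω ^ 2 ∂μ := fun i =>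
    ((hid i).comp (u := fun x : ℝ => x ^ 2) (by fun_prop)).integral_eq
  have hSm : ∀ s : Finset ℕ, Measurable fun ω => ∑ i ∈ s, Y i ω := fun s =>
    Finset.measurable_fun_sum s fun i _ => hmeas i
  have hSLp : ∀ s : Finset ℕ, MemLp (fun ω => ∑ i ∈ s, Y i ω) (ENNReal.ofReal p) μ := fun s =>
    memLp_finsetSum s fun i _ => hLpi i
  have hind : ∀ (s : Finset ℕ) (i : ℕ), i ∉ s → IndepFun (fun ω => ∑ j ∈ s, Y j ω) (Y i) μ := by
    intro s i hi
    have := hY.indepFun_finsetSum_of_notMem hmeas hi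
    convert this using 1
    funext ω
    simp
  have hc0 : 0 ≤ (1 + p) ^ p + p ^ p := (sq_nonneg p).trans (sq_le_one_add_rpow_add hp)
  have hm0 : 0 ≤ ∫ ω, |Y 0 ω| ^ p ∂μ := integral_nonneg fun ω => by positivity
  have hm2 : 0 ≤ ∫ ω, Y 0 ω ^ 2 ∂μ := integral_nonneg fun ω => by positivity
  rcases le_or_gt p 2 with hp2 | hp2
  · refine ⟨((1 + p) ^ p + p ^ p) * ∫ ω, |Y 0 ω| ^ p ∂μ, by positivity, fun s => ?_⟩
    rw [max_eq_left (by linarith), Real.rpow_one]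
    induction s using Finset.induction_on with
    | empty => simp [Real.zero_rpow (by linarith : p ≠ 0)]
    | insert i s hi ih =>
      have h1 := integral_abs_add_rpow_le_of_le_two hp hp2 (hSm s) (hSLp s) (hLpi i)
        (hind s i hi) (hY0i i)
      simp only [Finset.sum_insert hi, Finset.card_insert_of_notMem hi, add_comm (Y i _)]
      rw [hmom i] at h1
      push_cast
      linarith
  · set c := ((1 + p) ^ p + p ^ p) * (∫ ω, Y 0 ω ^ 2 ∂μ + ∫ ω, |Y 0 ω| ^ p ∂μ) + 1 with hcdef
    have hc : 0 < c := by positivity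
    set B := 2 * (c * (2 * c) ^ (p / 2 - 1) + c) with hB
    have hBc : 2 * c ≤ B := by
      have : 0 ≤ c * (2 * c) ^ (p / 2 - 1) := by positivity
      linarith
    refine ⟨B, by positivity, fun s => ?_⟩
    rw [max_eq_right (by linarith)]
    induction s using Finset.induction_on with
    | empty => simp [Real.zero_rpow (by linarith : p ≠ 0), Real.zero_rpow (by linarith : p / 2 ≠ 0)]
    | insert i s hi ih =>
      have h1 := integral_abs_add_rpow_le hp2 (hSm s) (hSLp s) (hLpi i)
        (hind s i hi) (hY0i i)
      rw [hmom i, hmom2 i] at h1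
      simp only [Finset.sum_insert hi, Finset.card_insert_of_notMem hi, add_comm (Y i _)]
      have hnn : 0 ≤ ∫ ω, |∑ j ∈ s, Y j ω| ^ (p - 2) ∂μ := integral_nonneg fun ω => by positivity
      have h2 : ∫ ω, |∑ j ∈ s, Y j ω + Y i ω| ^ p ∂μ ≤ ∫ ω, |∑ j ∈ s, Y j ω| ^ p ∂μ
          + (c * (∫ ω, |∑ j ∈ s, Y j ω| ^ (p - 2) ∂μ) + c) := by
        refine h1.trans (add_le_add le_rfl ?_)
        have h3 : 0 ≤ ((1 + p) ^ p + p ^ p) * ∫ ω, |Y 0 ω| ^ p ∂μ := by positivity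
        have h4 : 0 ≤ ((1 + p) ^ p + p ^ p) * ∫ ω, Y 0 ω ^ 2 ∂μ := by positivity
        have h5 : ((1 + p) ^ p + p ^ p) * ∫ ω, Y 0 ω ^ 2 ∂μ ≤ c := by rw [hcdef]; linarith
        have h6 : ((1 + p) ^ p + p ^ p) * ∫ ω, |Y 0 ω| ^ p ∂μ ≤ c := by rw [hcdef]; linarith
        have h7 := mul_le_mul_of_nonneg_right h5 hnn
        linarith
      rcases s.eq_empty_or_nonempty with rfl | hs
      · simp only [Finset.sum_empty, abs_zero, Real.zero_rpow (by linarith : p - 2 ≠ 0),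
          Real.zero_rpow (by linarith : p ≠ 0), integral_zero, mul_zero, zero_add] at h2
        simp
        linarith
      · have hk : (1 : ℝ) ≤ s.card := by exact_mod_cast hs.card_pos
        have hk0 : (0 : ℝ) < s.card := by linarith
        set k : ℝ := (s.card : ℝ) with hkdef
        -- the scale `2 * c * k` makes the interpolated term absorb half of the constant `B`
        have hρ : 0 < 2 * c * k := by positivity
        have hSp := integrable_abs_rpow_of_memLp (hSLp s) (q := p) (by linarith) le_rfl
        have h3 : ∫ ω, |∑ j ∈ s, Y j ω| ^ (p - 2) ∂μ
            ≤ (2 * c * k) ^ (p / 2 - 1) + (∫ ω, |∑ j ∈ s, Y j ω| ^ p ∂μ) / (2 * c * k) := by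
          calc _ ≤ ∫ ω, ((2 * c * k) ^ (p / 2 - 1) + |∑ j ∈ s, Y j ω| ^ p / (2 * c * k)) ∂μ :=
                integral_mono
                  (integrable_abs_rpow_of_memLp (hSLp s) (by linarith) (by linarith))
                  ((integrable_const _).add (hSp.div_const _))
                  fun ω => abs_rpow_sub_two_le hp2 hρ _
            _ = _ := by
                rw [integral_add (integrable_const _) (hSp.div_const _), integral_div]
                simp
        have h4 : k ^ (p / 2) = k ^ (p / 2 - 1) * k := by
          rw [← Real.rpow_add_one hk0.ne']
          congr 1
          ring
        have h5 : (2 * c * k) ^ (p / 2 - 1) = (2 * c) ^ (p / 2 - 1) * k ^ (p / 2 - 1) :=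
          Real.mul_rpow (by positivity) hk0.le
        have h6 : 1 ≤ k ^ (p / 2 - 1) := Real.one_le_rpow hk (by linarith)
        have h7 : (∫ ω, |∑ j ∈ s, Y j ω| ^ p ∂μ) / (2 * c * k) ≤ B * k ^ (p / 2 - 1) / (2 * c) := by
          rw [div_le_div_iff₀ hρ (by positivity)]
          have := mul_le_mul_of_nonneg_right ih (by positivity : 0 ≤ 2 * c)
          rw [h4] at this
          linarith
        have h8 : k ^ (p / 2) + k ^ (p / 2 - 1) ≤ (k + 1) ^ (p / 2) := by
          have h9 : (k + 1) ^ (p / 2) = (k + 1) ^ (p / 2 - 1) * (k + 1) := by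
            rw [← Real.rpow_add_one (by linarith)]
            congr 1
            ring
          have h10 : k ^ (p / 2 - 1) ≤ (k + 1) ^ (p / 2 - 1) :=
            Real.rpow_le_rpow hk0.le (by linarith) (by linarith)
          rw [h9, h4]
          nlinarith
        have h11 : c * (∫ ω, |∑ j ∈ s, Y j ω| ^ (p - 2) ∂μ) + c ≤ B * k ^ (p / 2 - 1) := by
          have h12 : c * (∫ ω, |∑ j ∈ s, Y j ω| ^ (p - 2) ∂μ)
              ≤ c * ((2 * c) ^ (p / 2 - 1) * k ^ (p / 2 - 1) + B * k ^ (p / 2 - 1) / (2 * c)) := by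
            refine mul_le_mul_of_nonneg_left ?_ hc.le
            rw [← h5]
            linarith
          have h13 : c * ((2 * c) ^ (p / 2 - 1) * k ^ (p / 2 - 1) + B * k ^ (p / 2 - 1) / (2 * c))
              = (c * (2 * c) ^ (p / 2 - 1) + B / 2) * k ^ (p / 2 - 1) := by
            field_simp
          have h14 : c ≤ c * k ^ (p / 2 - 1) := le_mul_of_one_le_right hc.le h6
          calc _ ≤ (c * (2 * c) ^ (p / 2 - 1) + B / 2) * k ^ (p / 2 - 1)
                + c * k ^ (p / 2 - 1) := by linarith
            _ = _ := by rw [hB]; ring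
        push_cast
        rw [← hkdef]
        have := mul_le_mul_of_nonneg_left h8 (by positivity : 0 ≤ B)
        linarith

end Moments

/-! ### Polynomial concentration for heavy tails -/

section HeavyTails

variable {Ω : Type*} [MeasurableSpace Ω] {μ : Measure Ω} [IsProbabilityMeasure μ]

lemma heavyExponent_pos {p : ℝ} (hp : 1 < p) : 0 < heavyExponent p := by
  unfold heavyExponent
  split_ifs <;> positivity

lemma heavyExponent_le_one {p : ℝ} (hp : 1 < p) : heavyExponent p ≤ 1 := by
  unfold heavyExponent
  split_ifs
  · rw [div_le_one (by linarith)]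
    linarith
  · rw [div_le_one (by linarith)]
    linarith

/-- The exponent of the decay of the tail of a sample mean in the number of observations. -/
lemma max_sub_eq_one_sub_inv_heavyExponent (p : ℝ) :
    max 1 (p / 2) - p = 1 - 1 / heavyExponent p := by
  unfold heavyExponent
  split_ifs with h
  · rw [max_eq_left (by linarith), one_div_one_div]
  · rw [max_eq_right (by linarith), one_div_one_div]
    ring

lemma IIDRewards.exists_measureReal_sampleMean_le {N : ℕ} {X : Fin N → ℕ → Ω → ℝ}
    (hX : IIDRewards μ X) {p : ℝ} (hp : 1 < p) (hLp : ∀ n, MemLp (X n 1) (ENNReal.ofReal p) μ)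
    {δ : ℝ} (hδ : 0 < δ) :
    ∃ D : ℝ, 0 ≤ D ∧ ∀ (A : Set ℕ) (n : Fin N) (t : ℕ), 0 < numObs A n t →
      μ.real {ω | δ ≤ |sampleMean X A n t ω - mean μ X n|}
        ≤ D * (numObs A n t : ℝ) ^ (1 - 1 / heavyExponent p) := by
  have hp0 : 0 < p := by linarith
  let Y : Fin N → ℕ → Ω → ℝ := fun n i ω => X n (i + 1) ω - mean μ X n
  have hB : ∀ n, ∃ B : ℝ, 0 ≤ B ∧ ∀ s : Finset ℕ, ∫ ω, |∑ i ∈ s, Y n i ω| ^ p ∂μ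
      ≤ B * (s.card : ℝ) ^ (max 1 (p / 2)) := by
    intro n
    refine exists_integral_abs_sum_rpow_le hp
      ((hX.indep n).comp (fun _ x => x - mean μ X n) fun _ => by fun_prop)
      (fun i => (hX.measurable n (i + 1) (by omega)).sub_const _)
      (fun i => (hX.identDistrib n (i + 1) (by omega)).comp (u := fun x => x - mean μ X n)
        (by fun_prop)) ((hLp n).sub (memLp_const _)) ?_
    change ∫ ω, (X n 1 ω - mean μ X n) ∂μ = 0
    rw [integral_sub (hX.integrable n) (integrable_const _)]
    simp [mean]
  choose B hB0 hBs using hB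
  refine ⟨(∑ n, B n) / δ ^ p, div_nonneg (Finset.sum_nonneg fun n _ => hB0 n) (by positivity),
    fun A n t ht => ?_⟩
  obtain ⟨s', hs'⟩ := exists_map_succ (s := armTimes A n (t - 1)) fun r hr =>
    one_le_of_mem_armTimes hr
  have hcard : s'.card = numObs A n t := by rw [numObs, hs', Finset.card_map]
  set k : ℝ := (numObs A n t : ℝ) with hk
  have hk0 : 0 < k := Nat.cast_pos.2 ht
  have hset : {ω | δ ≤ |sampleMean X A n t ω - mean μ X n|}
      ⊆ {ω | (k * δ) ^ p ≤ |∑ i ∈ s', Y n i ω| ^ p} := by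
    intro ω hω
    simp only [Set.mem_ofPred_eq] at hω ⊢
    have h1 : ∑ i ∈ s', Y n i ω = k * (sampleMean X A n t ω - mean μ X n) := by
      simp only [Y, Finset.sum_sub_distrib, Finset.sum_const, nsmul_eq_mul, sampleMean, hs',
        Finset.sum_map, Function.Embedding.coeFn_mk, Nat.succ_eq_add_one, hcard, ← hk]
      field_simp
    rw [h1, abs_mul, abs_of_pos hk0]
    gcongr
  have hSLp : MemLp (fun ω => ∑ i ∈ s', Y n i ω) (ENNReal.ofReal p) μ :=
    memLp_finsetSum s' fun i _ =>
      ((hX.identDistrib n (i + 1) (by omega)).memLp_iff.2 (hLp n)).sub (memLp_const _)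
  have hmarkov := mul_meas_ge_le_integral_of_nonneg
    (Eventually.of_forall fun ω => by positivity)
    (integrable_abs_rpow_of_memLp hSLp hp0.le le_rfl) ((k * δ) ^ p)
  have h2 := hBs n s'
  rw [hcard, ← hk] at h2
  have h3 : B n ≤ ∑ n, B n := Finset.single_le_sum (fun n _ => hB0 n) (Finset.mem_univ n)
  rw [← max_sub_eq_one_sub_inv_heavyExponent p, Real.rpow_sub hk0]
  refine (measureReal_mono hset (measure_ne_top _ _)).trans ?_
  have h4 : (∑ n, B n) / δ ^ p * (k ^ max 1 (p / 2) / k ^ p)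
      = (∑ n, B n) * k ^ max 1 (p / 2) / (k * δ) ^ p := by
    rw [Real.mul_rpow hk0.le hδ.le]
    field_simp
  rw [h4, le_div_iff₀ (by positivity), mul_comm]
  refine hmarkov.trans (h2.trans ?_)
  gcongr

end HeavyTails

/-! ### Exponential concentration of the truncated mean -/

/-- The number `x`, replaced by zero if its modulus exceeds `B`. -/
def truncate (B x : ℝ) : ℝ := if |x| ≤ B then x else 0

lemma measurable_truncate (B : ℝ) : Measurable (truncate B) :=
  Measurable.ite (measurableSet_le (by fun_prop) measurable_const) measurable_id measurable_const

lemma truncate_neg (B x : ℝ) : truncate B (-x) = -truncate B x := by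
  unfold truncate
  split_ifs <;> simp_all

lemma abs_truncate_le_abs (B x : ℝ) : |truncate B x| ≤ |x| := by
  unfold truncate
  split_ifs <;> simp

lemma abs_truncate_le {B b : ℝ} (hB : B ≤ b) (hb : 0 ≤ b) (x : ℝ) : |truncate B x| ≤ b := by
  unfold truncate
  split_ifs with h
  · exact h.trans hB
  · simpa using hb

lemma abs_sub_truncate_le {p B : ℝ} (hp : 1 < p) (hB : 0 < B) (x : ℝ) :
    |x - truncate B x| ≤ |x| ^ p * B ^ (1 - p) := by
  unfold truncate
  split_ifs with h
  · simp
    positivity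
  · have hx : 0 < |x| := hB.trans (not_le.1 h)
    rw [sub_zero]
    calc |x| = |x| ^ p * |x| ^ (1 - p) := by
          rw [← Real.rpow_add hx]
          simp
      _ ≤ |x| ^ p * B ^ (1 - p) :=
          mul_le_mul_of_nonneg_left
            (Real.rpow_le_rpow_of_nonpos hB (not_le.1 h).le (by linarith)) (by positivity)

section TruncatedMean

variable {Ω : Type*} [MeasurableSpace Ω] {μ : Measure Ω} [IsProbabilityMeasure μ]

lemma integrable_truncate {Y : Ω → ℝ} (hY : Measurable Y) {B b : ℝ} (hB : B ≤ b) (hb : 0 ≤ b) :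
    Integrable (fun ω => truncate B (Y ω)) μ :=
  Integrable.of_bound ((measurable_truncate B).comp hY).aestronglyMeasurable b
    (Eventually.of_forall fun ω => abs_truncate_le hB hb (Y ω))

lemma abs_integral_sub_truncate_le {Y : Ω → ℝ} (hYm : Measurable Y) (hY : Integrable Y μ)
    {p u B : ℝ} (hp : 1 < p) (hYp : Integrable (fun ω => |Y ω| ^ p) μ)
    (hu : ∫ ω, |Y ω| ^ p ∂μ ≤ u) (hB : 0 < B) :
    |∫ ω, truncate B (Y ω) ∂μ - ∫ ω, Y ω ∂μ| ≤ u * B ^ (1 - p) := by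
  rw [abs_sub_comm, ← integral_sub hY (integrable_truncate hYm le_rfl hB.le)]
  refine abs_integral_le_integral_abs.trans ?_
  calc ∫ ω, |Y ω - truncate B (Y ω)| ∂μ ≤ ∫ ω, |Y ω| ^ p * B ^ (1 - p) ∂μ :=
        integral_mono (hY.sub (integrable_truncate hYm le_rfl hB.le)).abs (hYp.mul_const _)
          fun ω => abs_sub_truncate_le hp hB (Y ω)
    _ ≤ u * B ^ (1 - p) := by
        rw [integral_mul_const]
        exact mul_le_mul_of_nonneg_right hu (by positivity)

lemma exp_mul_truncate_le {p c B b x : ℝ} (hp0 : 0 < p) (hp2 : p ≤ 2) (hB : B ≤ b) (hb : 0 ≤ b)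
    (hc : |c| * b ≤ 1) :
    Real.exp (c * truncate B x) ≤ 1 + c * truncate B x + |c| ^ p * |x| ^ p := by
  set z := truncate B x with hz
  have hcz : |c * z| ≤ 1 := by
    rw [abs_mul]
    exact (mul_le_mul_of_nonneg_left (abs_truncate_le hB hb x) (abs_nonneg c)).trans hc
  have h1 := (abs_le.1 (Real.abs_exp_sub_one_sub_id_le hcz)).2
  have h2 : (c * z) ^ 2 ≤ |c| ^ p * |x| ^ p := by
    rw [← Real.mul_rpow (abs_nonneg _) (abs_nonneg _), ← sq_abs, ← Real.rpow_natCast]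
    calc |c * z| ^ ((2 : ℕ) : ℝ) ≤ |c * z| ^ p :=
          Real.rpow_le_rpow_of_exponent_ge' (abs_nonneg _) hcz hp0.le (by exact_mod_cast hp2)
      _ ≤ (|c| * |x|) ^ p := by
          refine Real.rpow_le_rpow (abs_nonneg _) ?_ hp0.le
          rw [abs_mul]
          exact mul_le_mul_of_nonneg_left (abs_truncate_le_abs B x) (abs_nonneg c)
  linarith

lemma integrable_exp_mul_truncate {Y : Ω → ℝ} (hY : Measurable Y) {B b : ℝ} (hB : B ≤ b)
    (hb : 0 ≤ b) (c : ℝ) : Integrable (fun ω => Real.exp (c * truncate B (Y ω))) μ := by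
  refine Integrable.of_bound
    (Real.measurable_exp.comp (((measurable_truncate B).comp hY).const_mul c)).aestronglyMeasurable
    (Real.exp (|c| * b)) (Eventually.of_forall fun ω => ?_)
  rw [Real.norm_eq_abs, Real.abs_exp]
  refine Real.exp_le_exp.2 ((le_abs_self _).trans ?_)
  rw [abs_mul]
  exact mul_le_mul_of_nonneg_left (abs_truncate_le hB hb _) (abs_nonneg c)

lemma mgf_truncate_le {Y : Ω → ℝ} (hYm : Measurable Y) {p u c B b : ℝ} (hp0 : 0 < p) (hp2 : p ≤ 2)
    (hYp : Integrable (fun ω => |Y ω| ^ p) μ) (hu : ∫ ω, |Y ω| ^ p ∂μ ≤ u) (hB : B ≤ b)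
    (hb : 0 ≤ b) (hc : |c| * b ≤ 1) :
    mgf (fun ω => truncate B (Y ω)) μ c
      ≤ Real.exp (c * ∫ ω, truncate B (Y ω) ∂μ + |c| ^ p * u) := by
  have hT := integrable_truncate (μ := μ) hYm hB hb
  have hlin : Integrable (fun ω => 1 + c * truncate B (Y ω)) μ :=
    (integrable_const _).add (hT.const_mul c)
  calc mgf (fun ω => truncate B (Y ω)) μ c
      ≤ ∫ ω, (1 + c * truncate B (Y ω) + |c| ^ p * |Y ω| ^ p) ∂μ :=
        integral_mono (integrable_exp_mul_truncate hYm hB hb c) (hlin.add (hYp.const_mul _))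
          fun ω => exp_mul_truncate_le hp0 hp2 hB hb hc
    _ = (c * ∫ ω, truncate B (Y ω) ∂μ + |c| ^ p * ∫ ω, |Y ω| ^ p ∂μ) + 1 := by
        rw [integral_add hlin (hYp.const_mul _), integral_add (integrable_const _) (hT.const_mul c),
          integral_const_mul, integral_const_mul]
        simp
        ring
    _ ≤ (c * ∫ ω, truncate B (Y ω) ∂μ + |c| ^ p * u) + 1 := by gcongr
    _ ≤ _ := Real.add_one_le_exp _

/-- Chernoff's bound for a sum of truncated variables, with the parameter `1 / b`. -/
lemma measureReal_le_sum_truncate_le {Y : ℕ → Ω → ℝ} (hY : iIndepFun Y μ)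
    (hmeas : ∀ i, Measurable (Y i)) {p u : ℝ} (hp0 : 0 < p) (hp2 : p ≤ 2)
    (hYp : ∀ i, Integrable (fun ω => |Y i ω| ^ p) μ) (hu : ∀ i, ∫ ω, |Y i ω| ^ p ∂μ ≤ u)
    {b : ℝ} (hb : 0 < b) {B : ℕ → ℝ} {s : Finset ℕ} (hB : ∀ i ∈ s, B i ≤ b) (x : ℝ) :
    μ.real {ω | x ≤ ∑ i ∈ s, truncate (B i) (Y i ω)
        - ∑ i ∈ s, ∫ ω, truncate (B i) (Y i ω) ∂μ}
      ≤ Real.exp (-(x / b) + s.card * (u / b ^ p)) := by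
  have hc : |1 / b| * b ≤ 1 := by
    rw [abs_of_pos (by positivity)]
    exact le_of_eq (by field_simp)
  have h := measureReal_le_sum_le_exp (Y := fun i ω => truncate (B i) (Y i ω)) (s := s)
    (x := x + ∑ i ∈ s, ∫ ω, truncate (B i) (Y i ω) ∂μ)
    (hY.comp (fun i => truncate (B i)) fun i => measurable_truncate (B i))
    (fun i => (measurable_truncate (B i)).comp (hmeas i)) (by positivity : 0 ≤ 1 / b)
    (fun i hi => integrable_exp_mul_truncate (hmeas i) (hB i hi) hb.le _)
    (fun i hi => mgf_truncate_le (hmeas i) hp0 hp2 (hYp i) (hu i) (hB i hi) hb.le hc)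
  have hset : {ω | x ≤ ∑ i ∈ s, truncate (B i) (Y i ω)
        - ∑ i ∈ s, ∫ ω, truncate (B i) (Y i ω) ∂μ}
      = {ω | x + ∑ i ∈ s, ∫ ω, truncate (B i) (Y i ω) ∂μ
        ≤ ∑ i ∈ s, truncate (B i) (Y i ω)} := by
    ext ω
    simp only [Set.mem_ofPred_eq]
    exact le_sub_iff_add_le
  rw [hset]
  refine h.trans (le_of_eq ?_)
  congr 1
  rw [Finset.sum_add_distrib, ← Finset.mul_sum, Finset.sum_const, nsmul_eq_mul,
    abs_of_pos (by positivity), Real.div_rpow zero_le_one hb.le, Real.one_rpow]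
  ring

/-- The truncation biases of `k` observations add up to a bounded multiple of `k`: the thresholds
grow fast enough in the number of the observation. -/
lemma sum_truncation_bias_le {p u κ b : ℝ} (hp : 1 < p) (hu : 0 < u) (hκ : 0 < κ)
    (hb : b = (u / κ) ^ (1 / p)) {k : ℕ} (hk : 0 < k) :
    ∑ i ∈ Finset.Icc 1 k, u * ((u * i / (κ * k)) ^ (1 / p)) ^ (1 - p) ≤ p * (b * κ) * k := by
  have hp0 : 0 < p := by linarith
  have hk0 : (0 : ℝ) < k := by exact_mod_cast hk
  have hb0 : 0 < b := by rw [hb]; positivity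
  have hbp : b ^ p = u / κ := by
    rw [hb, ← Real.rpow_mul (by positivity), one_div_mul_cancel hp0.ne', Real.rpow_one]
  have hterm : ∀ i ∈ Finset.Icc 1 k, u * ((u * i / (κ * k)) ^ (1 / p)) ^ (1 - p)
      = b * κ * (k : ℝ) ^ (1 - 1 / p) * (i : ℝ) ^ (1 / p - 1) := by
    intro i hi
    have hi0 : (0 : ℝ) < i := by exact_mod_cast (Finset.mem_Icc.1 hi).1
    have h1 : (u * i / (κ * k)) ^ (1 / p) = b * ((i : ℝ) / k) ^ (1 / p) := by
      rw [hb, ← Real.mul_rpow (by positivity) (by positivity)]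
      congr 1
      field_simp
    have h2 : u * b ^ (1 - p) = b * κ := by
      rw [Real.rpow_sub hb0, Real.rpow_one, hbp]
      field_simp
    have h3 : (((i : ℝ) / k) ^ (1 / p)) ^ (1 - p) = (k : ℝ) ^ (1 - 1 / p) * (i : ℝ) ^ (1 / p - 1) := by
      rw [← Real.rpow_mul (by positivity), show 1 / p * (1 - p) = 1 / p - 1 by field_simp,
        Real.div_rpow hi0.le hk0.le, show 1 - 1 / p = -(1 / p - 1) by ring,
        Real.rpow_neg hk0.le]
      field_simp
    rw [h1, Real.mul_rpow hb0.le (by positivity), h3, ← h2]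
    ring
  rw [Finset.sum_congr rfl hterm, ← Finset.mul_sum]
  have hsum := sum_rpow_sub_one_le (e := 1 / p) (by positivity)
    (by rw [div_le_one hp0]; linarith) k
  calc _ ≤ b * κ * (k : ℝ) ^ (1 - 1 / p) * ((k : ℝ) ^ (1 / p) / (1 / p)) :=
        mul_le_mul_of_nonneg_left hsum (by positivity)
    _ = p * (b * κ) * ((k : ℝ) ^ (1 - 1 / p) * (k : ℝ) ^ (1 / p)) := by
        field_simp
    _ = p * (b * κ) * k := by
        rw [← Real.rpow_add hk0]
        simp

lemma IIDRewards.measureReal_truncMean_le {N : ℕ} {X : Fin N → ℕ → Ω → ℝ} (hX : IIDRewards μ X)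
    {p u κ δ : ℝ} (hp : 1 < p) (hp2 : p ≤ 2) (hu : 0 < u) (hκ : 0 < κ)
    (hbκ : (u / κ) ^ (1 / p) * κ = δ / 4) {A : Set ℕ} (n : Fin N)
    (hXp : Integrable (fun ω => |X n 1 ω| ^ p) μ) (hXu : ∫ ω, |X n 1 ω| ^ p ∂μ ≤ u)
    {t : ℕ} (ht : 0 < numObs A n t) :
    μ.real {ω | δ ≤ |truncMean X A p u κ n t ω - mean μ X n|}
      ≤ 2 * Real.exp (-κ * numObs A n t) := by
  have hp0 : 0 < p := by linarith
  set b := (u / κ) ^ (1 / p) with hb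
  have hb0 : 0 < b := by positivity
  have hbp : u / b ^ p = κ := by
    rw [hb, ← Real.rpow_mul (by positivity), one_div_mul_cancel hp0.ne', Real.rpow_one]
    field_simp
  set k := numObs A n t with hk
  have hk0 : (0 : ℝ) < k := Nat.cast_pos.2 ht
  let B : ℕ → ℝ := fun r => (u * (armTimes A n r).card / (κ * k)) ^ (1 / p)
  let Y : ℕ → Ω → ℝ := fun i => X n (i + 1)
  have hYm : ∀ i, Measurable (Y i) := fun i => hX.measurable n (i + 1) (by omega)
  have hYid : ∀ i, IdentDistrib (Y i) (X n 1) μ μ := fun i =>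
    hX.identDistrib n (i + 1) (by omega)
  have habsid : ∀ i, IdentDistrib (fun ω => |Y i ω| ^ p) (fun ω => |X n 1 ω| ^ p) μ μ := fun i =>
    (hYid i).comp (u := fun x : ℝ => |x| ^ p) (by fun_prop)
  have hYp : ∀ i, Integrable (fun ω => |Y i ω| ^ p) μ := fun i => (habsid i).integrable_iff.2 hXp
  have hYu : ∀ i, ∫ ω, |Y i ω| ^ p ∂μ ≤ u := fun i => by rwa [(habsid i).integral_eq]
  obtain ⟨s, hs⟩ := exists_map_succ (s := armTimes A n (t - 1)) fun r hr =>
    one_le_of_mem_armTimes hr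
  have hcard : s.card = k := by rw [hk, numObs, hs, Finset.card_map]
  have hBb : ∀ i ∈ s, B (i + 1) ≤ b := by
    intro i hi
    have hmem : i + 1 ∈ armTimes A n (t - 1) := by
      rw [hs]
      exact Finset.mem_map.2 ⟨i, hi, rfl⟩
    have hle : (armTimes A n (i + 1)).card ≤ k :=
      card_armTimes_mono A n (mem_explUpTo.1 (Finset.mem_filter.1 hmem).1).1.2
    refine Real.rpow_le_rpow (by positivity) ?_ (by positivity)
    rw [div_le_div_iff₀ (by positivity) hκ]
    have : ((armTimes A n (i + 1)).card : ℝ) ≤ k := by exact_mod_cast hle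
    have := mul_le_mul_of_nonneg_left this (mul_pos hu hκ).le
    linarith
  have htrunc : ∀ ω, k * truncMean X A p u κ n t ω
      = ∑ i ∈ s, truncate (B (i + 1)) (Y i ω) := by
    intro ω
    have hlog : Real.log (Real.exp (-κ * k))⁻¹ = κ * k := by
      rw [Real.log_inv, Real.log_exp]
      ring
    rw [truncMean, ← hk, hlog, mul_div_cancel₀ _ hk0.ne', hs, Finset.sum_map]
    rfl
  have hbias : |∑ i ∈ s, ∫ ω, truncate (B (i + 1)) (Y i ω) ∂μ - k * mean μ X n| ≤ k * (δ / 2) := by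
    have h1 : k * mean μ X n = ∑ i ∈ s, ∫ ω, Y i ω ∂μ := by
      rw [Finset.sum_congr rfl fun i _ => (hYid i).integral_eq, Finset.sum_const, nsmul_eq_mul,
        hcard]
      rfl
    rw [h1, ← Finset.sum_sub_distrib]
    calc _ ≤ ∑ i ∈ s, u * B (i + 1) ^ (1 - p) := by
          refine (Finset.abs_sum_le_sum_abs _ _).trans (Finset.sum_le_sum fun i hi => ?_)
          refine abs_integral_sub_truncate_le (hYm i)
            ((hYid i).integrable_iff.2 (hX.integrable n)) hp (hYp i) (hYu i) ?_
          have hmem : i + 1 ∈ armTimes A n (t - 1) := by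
            rw [hs]
            exact Finset.mem_map.2 ⟨i, hi, rfl⟩
          have : (0 : ℝ) < (armTimes A n (i + 1)).card := by
            exact_mod_cast card_armTimes_pos_of_mem hmem
          positivity
      _ = ∑ r ∈ armTimes A n (t - 1), u * B r ^ (1 - p) := by
          rw [hs, Finset.sum_map]
          rfl
      _ = ∑ i ∈ Finset.Icc 1 k, u * ((u * i / (κ * k)) ^ (1 / p)) ^ (1 - p) :=
          sum_armTimes_card A n (t - 1) fun i => u * ((u * i / (κ * k)) ^ (1 / p)) ^ (1 - p)
      _ ≤ p * (b * κ) * k := sum_truncation_bias_le hp hu hκ hb ht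
      _ ≤ k * (δ / 2) := by
          have hδ : 0 < b * κ := by positivity
          rw [show δ / 2 = 2 * (b * κ) by rw [hbκ]; ring]
          nlinarith [mul_pos hδ hk0]
  -- the bias takes one half of `δ`; Chernoff's bound with parameter `1 / b` handles the other half
  have hexp : -(k * (δ / 2) / b) + s.card * (u / b ^ p) = -κ * k := by
    rw [hbp, hcard, show δ / 2 = 2 * (b * κ) by rw [hbκ]; ring]
    field_simp
    ring
  have hup := measureReal_le_sum_truncate_le (hX.indep n) hYm hp0 hp2 hYp hYu hb0
    (B := fun i => B (i + 1)) hBb (k * (δ / 2))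
  rw [hexp] at hup
  have hlow := measureReal_le_sum_truncate_le (Y := fun i ω => -Y i ω)
    ((hX.indep n).comp (fun _ x => -x) fun _ => measurable_neg) (fun i => (hYm i).neg) hp0 hp2
    (by simpa only [abs_neg] using hYp) (by simpa only [abs_neg] using hYu) hb0
    (B := fun i => B (i + 1)) hBb (k * (δ / 2))
  rw [hexp] at hlow
  simp only [truncate_neg, Finset.sum_neg_distrib, integral_neg] at hlow
  refine le_trans (measureReal_mono ?_ (measure_ne_top _ _)) (measureReal_le_abs_le
    (Z := fun ω => ∑ i ∈ s, truncate (B (i + 1)) (Y i ω)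
      - ∑ i ∈ s, ∫ ω, truncate (B (i + 1)) (Y i ω) ∂μ) hup (le_of_eq_of_le ?_ hlow))
  · intro ω hω
    simp only [Set.mem_ofPred_eq] at hω ⊢
    have h1 : k * δ ≤ |k * (truncMean X A p u κ n t ω - mean μ X n)| := by
      rw [abs_mul, abs_of_pos hk0]
      exact mul_le_mul_of_nonneg_left hω hk0.le
    rw [mul_sub, htrunc] at h1
    have h2 := abs_sub_le (∑ i ∈ s, truncate (B (i + 1)) (Y i ω))
      (∑ i ∈ s, ∫ ω, truncate (B (i + 1)) (Y i ω) ∂μ) (k * mean μ X n)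
    linarith
  · congr 1
    ext ω
    simp only [Set.mem_ofPred_eq]
    rw [neg_sub, sub_neg_eq_add, neg_add_eq_sub]

end TruncatedMean

/-! ### Growth of the regret -/

lemma BelowNeighbourGaps.mono {N : ℕ} {Δ : Fin N → ℝ} {m : Fin N} {x y : ℝ}
    (h : BelowNeighbourGaps Δ m y) (hxy : x ≤ y) : BelowNeighbourGaps Δ m x :=
  ⟨fun j hj => hxy.trans_lt (h.1 j hj), fun j hj => hxy.trans_lt (h.2 j hj)⟩

section Growth

variable {Ω : Type*} [MeasurableSpace Ω] {μ : Measure Ω} [IsProbabilityMeasure μ] {N : ℕ}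
  [NeZero N] {X : Fin N → ℕ → Ω → ℝ} {σ : Equiv.Perm (Fin N)} {m : Fin N} {C : Fin N → ℝ}
  {A : Set ℕ} {π : ℕ → Ω → Fin N}

lemma IIDRewards.costRegret_isBigO_mul_log (hX : IIDRewards μ X) (hσ : IsRanking (mean μ X) σ)
    (hCm : C m = 0) (hC : ∀ j, j ≠ m → 0 < C j) (hlight : ∀ n, LightTailed μ (X n 1))
    (hg : BelowNeighbourGaps (gap (mean μ X) σ) m 0) {f : ℕ → ℝ} (hf : ∀ t, 1 ≤ t → 0 < f t)
    (hfmono : MonotoneOn f (Set.Ici 1)) (hflim : Tendsto f atTop atTop)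
    (hA : IsExploration A fun t => (N : ℝ) * ⌈f t * Real.log t⌉₊)
    (hπ : IsDSEEPolicy A (sampleMean X A) m π) :
    (fun T : ℕ => costRegret μ σ C π T) =O[atTop] fun T : ℕ => f T * Real.log T := by
  obtain ⟨ζ, u₀, hζ, hu₀, hconst⟩ := exists_lightTailConstants (X := X) hlight
  have hCH : ChernoffHoeffding μ X (1 / (2 * ζ)) ζ u₀ :=
    chernoffHoeffding_of_lightTailConstants hX hζ le_rfl hconst
  obtain ⟨δ₀, hδ₀, hgδ₀⟩ := exists_belowNeighbourGaps hg
  set δ := min δ₀ (ζ * u₀) with hδdef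
  have hδ : 0 < δ := lt_min hδ₀ (mul_pos hζ hu₀)
  have hgδ : BelowNeighbourGaps (gap (mean μ X) σ) m (2 * δ) :=
    hgδ₀.mono (by linarith [min_le_left δ₀ (ζ * u₀)])
  set κ := 1 / (2 * ζ) * δ ^ 2 with hκdef
  have hκ : 0 < κ := by positivity
  obtain ⟨t₁, ht₁⟩ := eventually_atTop.1 (hflim.eventually_ge_atTop (2 / κ))
  have hM := ciSup_cost_nonneg hCm
  have hlog : ∀ t : ℕ, 2 ≤ t → 0 < Real.log t := fun t ht =>
    Real.log_pos (by exact_mod_cast ht)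
  have hKmono : MonotoneOn (fun t : ℕ => ⌈f t * Real.log t⌉₊) (Set.Ici 1) := by
    intro x hx y hy hxy
    have hx' : (1 : ℝ) ≤ x := by exact_mod_cast (Set.mem_Ici.1 hx)
    exact Nat.ceil_mono (mul_le_mul (hfmono hx hy hxy)
      (Real.log_le_log (by linarith) (by exact_mod_cast hxy)) (Real.log_nonneg hx') (hf y hy).le)
  have hwrong : ∀ t, max t₁ 1 < t → t ∉ A →
      μ.real {ω | π t ω ≠ σ m} ≤ 2 * N * (t : ℝ) ^ (-2 : ℝ) := by
    intro t ht htA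
    obtain ⟨ht1, ht2⟩ := max_lt_iff.1 ht
    have htpos : (0 : ℝ) < t := by exact_mod_cast (by omega : 0 < t)
    have hfl : 0 < f t * Real.log t := mul_pos (hf t ht2.le) (hlog t ht2)
    have hobs : ∀ n : Fin N, ⌈f t * Real.log t⌉₊ ≤ numObs A n t := fun n =>
      le_numObs (K := fun t : ℕ => ⌈f t * Real.log t⌉₊) hA ht2 htA n
    have hpos : ∀ n : Fin N, 0 < numObs A n t := fun n =>
      (Nat.ceil_pos.2 hfl).trans_le (hobs n)
    refine (measureReal_wrong_le hσ hgδ hπ ht2.le htA hpos).trans ?_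
    have hle : ∀ n, μ.real {ω | δ ≤ |sampleMean X A n t ω - mean μ X n|}
        ≤ 2 * (t : ℝ) ^ (-2 : ℝ) := by
      intro n
      refine (measureReal_sampleMean_le hX hCH n (hpos n) hδ.le (min_le_right _ _)).trans ?_
      rw [← hκdef, Real.rpow_def_of_pos htpos]
      have h1 : f t * Real.log t ≤ numObs A n t :=
        (Nat.le_ceil _).trans (by exact_mod_cast hobs n)
      have h2 : 2 ≤ κ * f t := by
        have := ht₁ t ht1.le
        rwa [div_le_iff₀' hκ] at this
      have h3 : 2 * Real.log t ≤ κ * numObs A n t := by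
        have h4 := mul_le_mul_of_nonneg_left h1 hκ.le
        have h5 := mul_le_mul_of_nonneg_right h2 (hlog t ht2).le
        linarith
      have h4 : -κ * numObs A n t ≤ Real.log t * -2 := by linarith
      linarith [Real.exp_le_exp.2 h4]
    calc _ ≤ ∑ _n : Fin N, 2 * (t : ℝ) ^ (-2 : ℝ) := Finset.sum_le_sum fun n _ => hle n
      _ = _ := by
        simp
        ring
  have hsum : ∀ T : ℕ, ∑ t ∈ Finset.Icc 1 T, 2 * N * (t : ℝ) ^ (-2 : ℝ) ≤ 2 * N * 2 := by
    intro T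
    rw [← Finset.mul_sum]
    refine mul_le_mul_of_nonneg_left ?_ (by positivity)
    have hsub : Finset.Icc 1 T ⊆ insert 1 (Finset.Icc 2 T) := by
      intro s hs
      simp only [Finset.mem_insert, Finset.mem_Icc] at hs ⊢
      omega
    calc _ ≤ ∑ t ∈ insert 1 (Finset.Icc 2 T), (t : ℝ) ^ (-2 : ℝ) :=
          Finset.sum_le_sum_of_subset_of_nonneg hsub fun t _ _ => by positivity
      _ = 1 + ∑ t ∈ Finset.Icc 2 T, (t : ℝ) ^ (-2 : ℝ) := by
          rw [Finset.sum_insert (by simp)]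
          simp
      _ ≤ 2 := by
          have := sum_rpow_neg_le (q := 2) (by norm_num) T
          norm_num at this ⊢
          linarith
  have hlim : Tendsto (fun T : ℕ => f T * Real.log T) atTop atTop :=
    hflim.atTop_mul_atTop₀ (Real.tendsto_log_atTop.comp tendsto_natCast_atTop_atTop)
  refine IsBigO.of_bound
    ((⨆ j, C j) * (N * 2 + 1 + ((max t₁ 1 : ℕ) + 2 * N * 2))) ?_
  filter_upwards [hlim.eventually_ge_atTop 1, eventually_ge_atTop 1] with T hT1 hT
  have hreg := costRegret_le_card_add_sum (μ := μ) (σ := σ) hπ hCm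
    (b := fun t => 2 * N * (t : ℝ) ^ (-2 : ℝ)) (fun t => by positivity) hwrong T
  have hcard := card_explUpTo_le_add_one hA (fun x hx y hy hxy =>
    mul_le_mul_of_nonneg_left (by exact_mod_cast hKmono hx hy hxy) (Nat.cast_nonneg _)) hT
    (by positivity)
  have hceil := (Nat.ceil_lt_add_one (by linarith : 0 ≤ f T * Real.log T)).le
  have h1 : (N : ℝ) * ⌈f T * Real.log T⌉₊ ≤ N * 2 * (f T * Real.log T) := by
    have := mul_le_mul_of_nonneg_left hceil (Nat.cast_nonneg N : (0 : ℝ) ≤ N)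
    have := mul_le_mul_of_nonneg_left hT1 (Nat.cast_nonneg N : (0 : ℝ) ≤ N)
    linarith
  rw [Real.norm_of_nonneg (costRegret_nonneg hCm hC T), Real.norm_of_nonneg (by linarith),
    mul_assoc]
  refine hreg.trans (mul_le_mul_of_nonneg_left ?_ hM)
  have h2 : 1 + (((max t₁ 1 : ℕ) : ℝ) + 2 * N * 2)
      ≤ (1 + (((max t₁ 1 : ℕ) : ℝ) + 2 * N * 2)) * (f T * Real.log T) :=
    le_mul_of_one_le_right (by positivity) hT1
  linarith [hsum T]

lemma IIDRewards.costRegret_isBigO_rpow (hX : IIDRewards μ X) (hσ : IsRanking (mean μ X) σ)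
    (hCm : C m = 0) (hC : ∀ j, j ≠ m → 0 < C j) {p v : ℝ} (hp : 1 < p) (hv : 0 < v)
    (hLp : ∀ n, MemLp (X n 1) (ENNReal.ofReal p) μ)
    (hg : BelowNeighbourGaps (gap (mean μ X) σ) m 0)
    (hA : IsExploration A fun t => v * (t : ℝ) ^ heavyExponent p)
    (hπ : IsDSEEPolicy A (sampleMean X A) m π) :
    (fun T : ℕ => costRegret μ σ C π T) =O[atTop] fun T : ℕ => (T : ℝ) ^ heavyExponent p := by
  obtain ⟨δ, hδ, hgδ⟩ := exists_belowNeighbourGaps hg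
  obtain ⟨D, hD, hconc⟩ := hX.exists_measureReal_sampleMean_le hp hLp hδ
  have he := heavyExponent_pos hp
  have he1 := heavyExponent_le_one hp
  set e := heavyExponent p with hedef
  have hN : (0 : ℝ) < N := by exact_mod_cast NeZero.pos N
  have hM := ciSup_cost_nonneg hCm
  have hpow : Tendsto (fun T : ℕ => (T : ℝ) ^ e) atTop atTop :=
    (tendsto_rpow_atTop he).comp tendsto_natCast_atTop_atTop
  obtain ⟨t₁, ht₁⟩ := eventually_atTop.1 (hpow.eventually_ge_atTop (2 * N / v))
  set γ := v / (2 * N) with hγdef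
  have hγ : 0 < γ := by positivity
  set b : ℕ → ℝ := fun t => N * D * γ ^ (1 - 1 / e) * (t : ℝ) ^ (e - 1) with hb
  have hb0 : ∀ t, 0 ≤ b t := fun t => by positivity
  have hexp : 1 - 1 / e ≤ 0 := by
    have : 1 ≤ 1 / e := by rwa [le_div_iff₀ he, one_mul]
    linarith
  have hwrong : ∀ t, max t₁ 1 < t → t ∉ A → μ.real {ω | π t ω ≠ σ m} ≤ b t := by
    intro t ht htA
    obtain ⟨ht1, ht2⟩ := max_lt_iff.1 ht
    have htpos : (0 : ℝ) < t := by exact_mod_cast (by omega : 0 < t)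
    have hexpl : v * (t : ℝ) ^ e ≤ (explUpTo A (t - 1)).card :=
      not_lt.1 fun h => htA ((hA t ht2).2 h)
    have hlarge : 2 * N ≤ v * (t : ℝ) ^ e := by
      have := ht₁ t ht1.le
      rwa [div_le_iff₀' hv] at this
    -- the round-robin order gives every arm its share of the explorations, up to one
    have hobs : ∀ n : Fin N, γ * (t : ℝ) ^ e ≤ numObs A n t := by
      intro n
      have h1 : (explUpTo A (t - 1)).card < N * (numObs A n t + 1) :=
        (Nat.lt_mul_div_succ _ (NeZero.pos N)).trans_le
          (Nat.mul_le_mul_left _ (Nat.add_le_add_right (card_armTimes_ge_div A n (t - 1)) 1))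
      have h2 : ((explUpTo A (t - 1)).card : ℝ) < N * (numObs A n t + 1) := by exact_mod_cast h1
      rw [hγdef, div_mul_eq_mul_div, div_le_iff₀ (by positivity)]
      linarith
    have hposR : 0 < γ * (t : ℝ) ^ e := by positivity
    have hpos : ∀ n : Fin N, 0 < numObs A n t := fun n => by
      exact_mod_cast hposR.trans_le (hobs n)
    refine (measureReal_wrong_le hσ hgδ hπ ht2.le htA hpos).trans ?_
    have hle : ∀ n, μ.real {ω | δ ≤ |sampleMean X A n t ω - mean μ X n|}
        ≤ D * (γ ^ (1 - 1 / e) * (t : ℝ) ^ (e - 1)) := by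
      intro n
      refine (hconc A n t (hpos n)).trans (mul_le_mul_of_nonneg_left ?_ hD)
      refine (Real.rpow_le_rpow_of_nonpos hposR (hobs n) hexp).trans (le_of_eq ?_)
      rw [Real.mul_rpow hγ.le (by positivity), ← Real.rpow_mul htpos.le]
      congr 2
      field_simp
    calc _ ≤ ∑ _n : Fin N, D * (γ ^ (1 - 1 / e) * (t : ℝ) ^ (e - 1)) :=
          Finset.sum_le_sum fun n _ => hle n
      _ = b t := by
        simp [hb]
        ring
  refine IsBigO.of_bound ((⨆ j, C j) * (v + 1 + ((max t₁ 1 : ℕ)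
    + N * D * γ ^ (1 - 1 / e) / e))) ?_
  filter_upwards [eventually_ge_atTop 1] with T hT
  have hT1 : (1 : ℝ) ≤ (T : ℝ) ^ e := Real.one_le_rpow (by exact_mod_cast hT) he.le
  have hreg := costRegret_le_card_add_sum (μ := μ) (σ := σ) hπ hCm hb0 hwrong T
  have hcard := card_explUpTo_le_add_one hA (fun x hx y hy hxy =>
    mul_le_mul_of_nonneg_left (Real.rpow_le_rpow (Nat.cast_nonneg _) (by exact_mod_cast hxy) he.le)
      hv.le) hT (by positivity)
  have hsum : ∑ t ∈ Finset.Icc 1 T, b t ≤ N * D * γ ^ (1 - 1 / e) / e * (T : ℝ) ^ e := by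
    rw [hb, ← Finset.mul_sum]
    calc _ ≤ N * D * γ ^ (1 - 1 / e) * ((T : ℝ) ^ e / e) :=
          mul_le_mul_of_nonneg_left (sum_rpow_sub_one_le he he1 T) (by positivity)
      _ = _ := by ring
  rw [Real.norm_of_nonneg (costRegret_nonneg hCm hC T), Real.norm_of_nonneg (by positivity),
    mul_assoc]
  refine hreg.trans (mul_le_mul_of_nonneg_left ?_ hM)
  have h2 : 1 + ((max t₁ 1 : ℕ) : ℝ) ≤ (1 + ((max t₁ 1 : ℕ) : ℝ)) * (T : ℝ) ^ e :=
    le_mul_of_one_le_right (by positivity) hT1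
  linarith

end Growth

/-- The constant `a = 4 ^ (p / (1 - p)) * u ^ (1 / (1 - p))` is the one for which the truncation
level `(u / κ) ^ (1 / p)`, with `κ = a * δ ^ (p / (p - 1))`, is `δ / (4 * κ)`. -/
lemma truncation_level_mul {p u a δ : ℝ} (hp : 1 < p) (hu : 0 < u) (hδ : 0 < δ)
    (ha : a = (4 : ℝ) ^ (p / (1 - p)) * u ^ (1 / (1 - p))) :
    (u / (a * δ ^ (p / (p - 1)))) ^ (1 / p) * (a * δ ^ (p / (p - 1))) = δ / 4 := by
  have hp0 : p ≠ 0 := by linarith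
  have hp1 : p - 1 ≠ 0 := by linarith
  have hp1' : 1 - p ≠ 0 := by linarith
  have ha0 : 0 < a := by rw [ha]; positivity
  set κ := a * δ ^ (p / (p - 1)) with hκdef
  have hκ : 0 < κ := by positivity
  have h1 : (u / κ) ^ (1 / p) * κ = u ^ (1 / p) * κ ^ ((p - 1) / p) := by
    rw [Real.div_rpow hu.le hκ.le, show (p - 1) / p = 1 - 1 / p by field_simp,
      Real.rpow_sub hκ, Real.rpow_one]
    ring
  have h2 : κ ^ ((p - 1) / p) = (4 : ℝ) ^ (-1 : ℝ) * u ^ (-(1 / p)) * δ := by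
    rw [hκdef, ha, Real.mul_rpow (by positivity) (by positivity),
      Real.mul_rpow (by positivity) (by positivity), ← Real.rpow_mul (by norm_num),
      ← Real.rpow_mul hu.le, ← Real.rpow_mul hδ.le]
    have e1 : p / (1 - p) * ((p - 1) / p) = -1 := by
      field_simp
      ring
    have e2 : 1 / (1 - p) * ((p - 1) / p) = -(1 / p) := by
      field_simp
      ring
    have e3 : p / (p - 1) * ((p - 1) / p) = 1 := by
      field_simp
    rw [e1, e2, e3, Real.rpow_one]
  rw [h1, h2, Real.rpow_neg hu.le, Real.rpow_neg_one]
  field_simp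

end DSEE

end

theorem theorem5 {Ω : Type*} [MeasurableSpace Ω] (μ : Measure Ω) [IsProbabilityMeasure μ]
    (N : ℕ) [NeZero N] (X : Fin N → ℕ → Ω → ℝ) (hX : DSEE.IIDRewards μ X)
    (σ : Equiv.Perm (Fin N)) (hσ : DSEE.IsRanking (DSEE.mean μ X) σ)
    (m : Fin N) (C : Fin N → ℝ) (hCm : C m = 0) (hC : ∀ j, j ≠ m → 0 < C j) :
    -- logarithmic regret, light tails
    (∀ a ζ u₀ c δ w : ℝ, 0 < a → 0 < ζ → 0 < u₀ →
      ((DSEE.LightTailConstants μ X ζ u₀ ∧ a ≤ 1 / (2 * ζ)) ∨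
        DSEE.ChernoffHoeffding μ X a ζ u₀) →
      0 < c → DSEE.BelowNeighbourGaps (DSEE.gap (DSEE.mean μ X) σ) m c →
      δ = min (c / 2) (ζ * u₀) → 1 / (a * δ ^ 2) < w →
      ∀ (A : Set ℕ) (π : ℕ → Ω → Fin N),
        DSEE.IsExploration A (fun t => (N : ℝ) * ⌈w * Real.log t⌉₊) →
        DSEE.IsDSEEPolicy A (DSEE.sampleMean X A) m π →
        ∀ T : ℕ, DSEE.costRegret μ σ C π T ≤
          (∑ j ∈ Finset.univ.erase m, (⌈w * Real.log T⌉₊ : ℝ) * C j)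
            + 2 * N * (⨆ j, C j) * (1 + 1 / (a * δ ^ 2 * w - 1))) ∧
    -- near-logarithmic regret, light tails, no knowledge of the reward model
    ((∀ n, DSEE.LightTailed μ (X n 1)) →
      DSEE.BelowNeighbourGaps (DSEE.gap (DSEE.mean μ X) σ) m 0 →
      ∀ f : ℕ → ℝ, (∀ t, 1 ≤ t → 0 < f t) → MonotoneOn f (Set.Ici 1) →
        Tendsto f atTop atTop →
      ∀ (A : Set ℕ) (π : ℕ → Ω → Fin N),
        DSEE.IsExploration A (fun t => (N : ℝ) * ⌈f t * Real.log t⌉₊) →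
        DSEE.IsDSEEPolicy A (DSEE.sampleMean X A) m π →
        (fun T : ℕ => DSEE.costRegret μ σ C π T) =O[atTop]
          (fun T : ℕ => f T * Real.log T)) ∧
    -- sublinear regret, heavy tails
    (∀ p v : ℝ, 1 < p → 0 < v →
      (∀ n, MemLp (X n 1) (ENNReal.ofReal p) μ) →
      DSEE.BelowNeighbourGaps (DSEE.gap (DSEE.mean μ X) σ) m 0 →
      ∀ (A : Set ℕ) (π : ℕ → Ω → Fin N),
        DSEE.IsExploration A (fun t => v * (t : ℝ) ^ DSEE.heavyExponent p) →
        DSEE.IsDSEEPolicy A (DSEE.sampleMean X A) m π →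
        (fun T : ℕ => DSEE.costRegret μ σ C π T) =O[atTop]
          (fun T : ℕ => (T : ℝ) ^ DSEE.heavyExponent p)) ∧
    -- logarithmic regret, heavy tails, truncated sample mean
    (∀ p u a δ w : ℝ, 1 < p → p ≤ 2 → 0 < u →
      (∀ n, Integrable (fun ω => |X n 1 ω| ^ p) μ ∧ ∫ ω, |X n 1 ω| ^ p ∂μ ≤ u) →
      a = (4 : ℝ) ^ (p / (1 - p)) * u ^ (1 / (1 - p)) →
      0 < δ → DSEE.BelowNeighbourGaps (DSEE.gap (DSEE.mean μ X) σ) m (2 * δ) →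
      1 / (a * δ ^ (p / (p - 1))) < w →
      ∀ (A : Set ℕ) (π : ℕ → Ω → Fin N),
        DSEE.IsExploration A (fun t => (N : ℝ) * ⌈w * Real.log t⌉₊) →
        DSEE.IsDSEEPolicy A (DSEE.truncMean X A p u (a * δ ^ (p / (p - 1)))) m π →
        ∀ T : ℕ, DSEE.costRegret μ σ C π T ≤
          (∑ j ∈ Finset.univ.erase m, (⌈w * Real.log T⌉₊ : ℝ) * C j)
            + 2 * N * (⨆ j, C j) * (1 + 1 / (a * δ ^ (p / (p - 1)) * w - 1))) := by
  refine ⟨?_, ?_, ?_, ?_⟩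
  · intro a ζ u₀ c δ w ha hζ hu₀ htail hc hg hδ hw A π hA hπ T
    have hCH : DSEE.ChernoffHoeffding μ X a ζ u₀ := by
      rcases htail with ⟨h, ha'⟩ | h
      · exact DSEE.chernoffHoeffding_of_lightTailConstants hX hζ ha' h
      · exact h
    have hδ0 : 0 < δ := hδ ▸ lt_min (by linarith) (mul_pos hζ hu₀)
    have hδc : δ ≤ c / 2 := hδ ▸ min_le_left _ _
    have hδζ : δ ≤ ζ * u₀ := hδ ▸ min_le_right _ _
    exact DSEE.costRegret_le_of_exponential_concentration hσ (hg.mono (by linarith)) hCm hC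
      (by positivity) hw hA hπ
      (fun n t ht => DSEE.measureReal_sampleMean_le hX hCH n ht hδ0.le hδζ) T
  · intro hlight hg f hf hfmono hflim A π hA hπ
    exact hX.costRegret_isBigO_mul_log hσ hCm hC hlight hg hf hfmono hflim hA hπ
  · intro p v hp hv hLp hg A π hA hπ
    exact hX.costRegret_isBigO_rpow hσ hCm hC hp hv hLp hg hA hπ
  · intro p u a δ w hp hp2 hu hmom ha hδ hg hw A π hA hπ T
    have ha0 : 0 < a := by rw [ha]; positivity
    have hκ : 0 < a * δ ^ (p / (p - 1)) := by positivity
    exact DSEE.costRegret_le_of_exponential_concentration hσ hg hCm hC hκ hw hA hπ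
      (fun n t ht => hX.measureReal_truncMean_le hp hp2 hu hκ
        (DSEE.truncation_level_mul hp hu hδ ha) n (hmom n).1 (hmom n).2 ht) T
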